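/- Lemma (Gradient heterogeneity). Let $\mathcal T^{(i)}=(A^{(i)},B^{(i)},Q^{(i)},R^{(i)})$, $i\in[M]$, be LQR tasks with $A^{(i)}\in\mathbb R^{n_x\times n_x}$, $B^{(i)}\in\mathbb R^{n_x\times n_u}$ and $Q^{(i)}\in\mathbb R^{n_x\times n_x}$, $R^{(i)}\in\mathbb R^{n_u\times n_u}$ symmetric positive definite. Let the initial state $x_0$ have a law $\mathcal X_0$ on $\mathbb R^{n_x}$ with finite second moments and $\Sigma_0:=\mathbb E[x_0x_0^\top]\succ 0$, the same for all tasks. A controller $K\in\mathbb R^{n_u\times n_x}$ stabilizes task $i$ if $\rho(A^{(i)}-B^{(i)}K)<1$, and its cost is $$J^{(i)}(K)=\mathbb E_{x_0\sim\mathcal X_0}\Big[\sum_{t=0}^\infty x_t^\top\big(Q^{(i)}+K^\top R^{(i)}K\big)x_t\Big],\qquad x_{t+1}=A^{(i)}x_t+B^{(i)}u_t,\quad u_t=-Kx_t .$$ $\nabla J^{(i)}(K)$ is the gradient of $J^{(i)}$ at $K$ for the Frobenius inner product, i.e. the matrix of its partial derivatives in the entries of $K$. Given a controller $K_0$ that stabilizes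 all tasks and constants $\gamma_i>0$, let $\mathcal S_{\rm ML}$ be the set of all $K$ which, for every $i\in[M]$, stabilize task $i$ and satisfy $J^{(i)}(K)-J^{(i)}(K_i^\star)\le\gamma_i\big(J^{(i)}(K_0)-J^{(i)}(K_i^\star)\big)$, where $K_i^\star$ minimizes $J^{(i)}$ over the controllers stabilizing task $i$. Let $\|\cdot\|$ be the spectral norm and $\sigma_{\min}$ the smallest singular value, and write $\|S\|_{\max}=\max_i\|S^{(i)}\|$ for a family of matrices. Let $P_K^{(i)}\succ0$ be the solution of $P=Q^{(i)}+K^\top R^{(i)}K+(A^{(i)}-B^{(i)}K)^\top P(A^{(i)}-B^{(i)}K)$, and put $J_{\max}(K)=\max_iJ^{(i)}(K)$, $\sigma_Q=\min_i\sigma_{\min}(Q^{(i)})$, $\mu=\sigma_{\min}(\Sigma_0)$, $\nu(K)=\dfrac{J_{\max}(K)}{\sigma_Q\,\mu}$, $$e(K)=\|R\|_{\max}\|K\|+\frac{J_{\max}(K)\big(\|B\|_{\max}^2\|K\|+\|B\|_{\max}\|A\|_{\max}\big)}{\mu},$$ \begin{align*} h^1_{\rm het}(K)&=\tfrac{J_{\max}(K)}{\sigma_Q}\|B\|_{\max}\Big(\|P_K\|_{\max}+4\|A-BK\|_{\max}^2\big(\|Q\|_{\max}+\|K\|^2\|R\|_{\max}\big)\nu^2(K)\Big)\\&\quad+4e(K)\nu^2(K)\|A-BK\|_{\max}\|\Sigma_0\|,\\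 h^2_{\rm het}(K)&=\tfrac{J_{\max}(K)}{\sigma_Q}\Big(\|A-BK\|_{\max}\|P_K\|_{\max}+\|B\|_{\max}\|P_K\|_{\max}\|K\|\\&\qquad+4\|K\|\|A-BK\|_{\max}^2\big(\|Q\|_{\max}+\|K\|^2\|R\|_{\max}\big)\nu^2(K)\Big)\\&\quad+4e(K)\nu^2(K)\|K\|\|A-BK\|_{\max}\|\Sigma_0\|,\\ h^3_{\rm het}(K)&=\tfrac{J_{\max}(K)}{\sigma_Q}\|B\|_{\max}\|A-BK\|_{\max}\nu(K),\\ h^4_{\rm het}(K)&=\tfrac{J_{\max}(K)}{\sigma_Q}\Big(\|K\|+\|K\|^2\|B\|_{\max}\|A-BK\|_{\max}\nu(K)\Big) \end{align*} (for $n_x\ge1$; if $n_x=0$, quotients by $0$ are read as $0$). Let $K\in\mathcal S_{\rm ML}$, let $i,j\in[M]$, and let $\epsilon_1,\dots,\epsilon_4$ satisfy $\|A^{(i)}-A^{(j)}\|\le\epsilon_1$, $\|B^{(i)}-B^{(j)}\|\le\epsilon_2$, $\|Q^{(i)}-Q^{(j)}\|\le\epsilon_3$, $\|R^{(i)}-R^{(j)}\|\le\epsilon_4$.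 Then $J^{(i)}$ and $J^{(j)}$ are differentiable at $K$, the numbers $h^k_{\rm het}(K)$ are nonnegative, and $$\|\nabla J^{(i)}(K)-\nabla J^{(j)}(K)\|\le 2\big(\epsilon_1h^1_{\rm het}(K)+\epsilon_2h^2_{\rm het}(K)+\epsilon_3h^3_{\rm het}(K)+\epsilon_4h^4_{\rm het}(K)\big).$$ Moreover, if $Q^{(i)}=Q^{(j)}$ and $R^{(i)}=R^{(j)}$ (system heterogeneity), the bound holds without the terms in $\epsilon_3,\epsilon_4$; if $A^{(i)}=A^{(j)}$ and $B^{(i)}=B^{(j)}$ (cost heterogeneity), it holds without the terms in $\epsilon_1,\epsilon_2$. -/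

import Mathlib

open scoped Matrix Matrix.Norms.L2Operator
open MeasureTheory

namespace MetaLQR

/-! Throughout, the norm on matrices is the spectral norm (the operator norm induced by the
Euclidean norms), and `X₀` is the law of the initial state, shared by all tasks. -/

/-- An LQR task `(A, B, Q, R)` with symmetric positive definite cost matrices. -/
structure LQRTask (nx nu : ℕ) where
  A : Matrix (Fin nx) (Fin nx) ℝ
  B : Matrix (Fin nx) (Fin nu) ℝ
  Q : Matrix (Fin nx) (Fin nx) ℝ
  R : Matrix (Fin nu) (Fin nu) ℝ
  posDef_Q : Q.PosDef
  posDef_R : R.PosDef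

variable {nx nu M : ℕ}

/-- The smallest singular value of a square matrix (singular values are listed in decreasing
order, starting from index `0`). -/
noncomputable def sigmaMin {n : ℕ} (S : Matrix (Fin n) (Fin n) ℝ) : ℝ :=
  (Matrix.toEuclideanLin S).singularValues (n - 1)

/-- The second moment matrix `Σ₀ = 𝔼[x₀ x₀ᵀ]` of the initial state. -/
noncomputable def secondMoment (X₀ : Measure (Fin nx → ℝ)) : Matrix (Fin nx) (Fin nx) ℝ :=
  Matrix.of fun k l => ∫ x, x k * x l ∂X₀

namespace LQRTask

variable (T : LQRTask nx nu)

/-- The closed-loop matrix `A - B K`. -/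
def closedLoop (K : Matrix (Fin nu) (Fin nx) ℝ) : Matrix (Fin nx) (Fin nx) ℝ :=
  T.A - T.B * K

/-- `K` is stabilizing for the task: the spectral radius of `A - B K` (over all complex
eigenvalues) is smaller than one. -/
def IsStabilizing (K : Matrix (Fin nu) (Fin nx) ℝ) : Prop :=
  spectralRadius ℂ ((T.closedLoop K).map (algebraMap ℝ ℂ)) < 1

/-- The state trajectory `x_{t+1} = A x_t + B u_t` with the input `u_t = -K x_t`. -/
def state (K : Matrix (Fin nu) (Fin nx) ℝ) (x₀ : Fin nx → ℝ) : ℕ → Fin nx → ℝ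
  | 0 => x₀
  | t + 1 => T.A *ᵥ state K x₀ t + T.B *ᵥ (-(K *ᵥ state K x₀ t))

/-- The stage-cost matrix `Q + Kᵀ R K`. -/
def stageCost (K : Matrix (Fin nu) (Fin nx) ℝ) : Matrix (Fin nx) (Fin nx) ℝ :=
  T.Q + Kᵀ * T.R * K

/-- The LQR cost `J(K) = 𝔼[∑_{t ≥ 0} x_tᵀ (Q + Kᵀ R K) x_t]`, where `x₀ ∼ X₀`. -/
noncomputable def cost (X₀ : Measure (Fin nx → ℝ)) (K : Matrix (Fin nu) (Fin nx) ℝ) : ℝ :=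
  ∫ x₀, ∑' t : ℕ, T.state K x₀ t ⬝ᵥ (T.stageCost K *ᵥ T.state K x₀ t) ∂X₀

/-- The gradient of the cost at `K` (with respect to the Frobenius inner product): the matrix of
the partial derivatives of `J` in the entries of `K`. -/
noncomputable def gradCost (X₀ : Measure (Fin nx → ℝ)) (K : Matrix (Fin nu) (Fin nx) ℝ) :
    Matrix (Fin nu) (Fin nx) ℝ :=
  Matrix.of fun a b => fderiv ℝ (T.cost X₀) K (Matrix.single a b 1)

/-- `P` is a positive definite solution of the Lyapunov equation
`P = Q + Kᵀ R K + (A - B K)ᵀ P (A - B K)`. -/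
def IsLyapunovSolution (K : Matrix (Fin nu) (Fin nx) ℝ) (P : Matrix (Fin nx) (Fin nx) ℝ) : Prop :=
  P.PosDef ∧ P = T.stageCost K + (T.closedLoop K)ᵀ * P * T.closedLoop K

/-- The matrix `P_K`: the positive definite solution of the Lyapunov equation (it exists and is
unique when `K` is stabilizing). -/
noncomputable def lyapunov (K : Matrix (Fin nu) (Fin nx) ℝ) : Matrix (Fin nx) (Fin nx) ℝ :=
  Classical.epsilon (T.IsLyapunovSolution K)

/-- The optimal cost: the minimum of `J` over all stabilizing controllers. -/
noncomputable def optCost (X₀ : Measure (Fin nx → ℝ)) : ℝ :=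
  sInf (T.cost X₀ '' {K | T.IsStabilizing K})

/-- The task-specific stabilizing sub-level set: the stabilizing `K` with
`J(K) - J(K⋆) ≤ γ (J(K₀) - J(K⋆))`. -/
def stabSublevel (X₀ : Measure (Fin nx → ℝ)) (K₀ : Matrix (Fin nu) (Fin nx) ℝ) (γ : ℝ) :
    Set (Matrix (Fin nu) (Fin nx) ℝ) :=
  {K | T.IsStabilizing K ∧
    T.cost X₀ K - T.optCost X₀ ≤ γ * (T.cost X₀ K₀ - T.optCost X₀)}

end LQRTask

/-- The MAML stabilizing sub-level set: the intersection of the task-specific ones. -/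
def stabSublevelML (T : Fin M → LQRTask nx nu) (X₀ : Measure (Fin nx → ℝ))
    (K₀ : Matrix (Fin nu) (Fin nx) ℝ) (γ : Fin M → ℝ) : Set (Matrix (Fin nu) (Fin nx) ℝ) :=
  ⋂ i, (T i).stabSublevel X₀ K₀ (γ i)

/-- `‖S‖_max = max_i ‖S⁽ⁱ⁾‖`. -/
noncomputable def normMax {m n : ℕ} (S : Fin M → Matrix (Fin m) (Fin n) ℝ) : ℝ :=
  ⨆ i, ‖S i‖

section Polynomials

variable (T : Fin M → LQRTask nx nu) (X₀ : Measure (Fin nx → ℝ)) (K : Matrix (Fin nu) (Fin nx) ℝ)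

/-- `J_max(K) = max_i J⁽ⁱ⁾(K)`. -/
noncomputable def costMax : ℝ := ⨆ i, (T i).cost X₀ K

/-- `min_i σ_min(Q⁽ⁱ⁾)`. -/
noncomputable def sigmaMinQ : ℝ := ⨅ i, sigmaMin (T i).Q

/-- `‖A‖_max`. -/
noncomputable def nA : ℝ := normMax fun i => (T i).A

/-- `‖B‖_max`. -/
noncomputable def nB : ℝ := normMax fun i => (T i).B

/-- `‖Q‖_max`. -/
noncomputable def nQ : ℝ := normMax fun i => (T i).Q

/-- `‖R‖_max`. -/
noncomputable def nR : ℝ := normMax fun i => (T i).R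

/-- `‖A - B K‖_max`. -/
noncomputable def nL : ℝ := normMax fun i => (T i).closedLoop K

/-- `‖P_K‖_max`. -/
noncomputable def nP : ℝ := normMax fun i => (T i).lyapunov K

/-- `μ = σ_min(Σ₀)`. -/
noncomputable def mu : ℝ := sigmaMin (secondMoment X₀)

/-- `ν(K) = J_max(K) / (min_i σ_min(Q⁽ⁱ⁾) μ)`. -/
noncomputable def nuK : ℝ := costMax T X₀ K / (sigmaMinQ T * mu X₀)

/-- `‖R‖_max ‖K‖ + J_max(K) (‖B‖_max² ‖K‖ + ‖B‖_max ‖A‖_max) / μ`. -/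
noncomputable def boundE : ℝ :=
  nR T * ‖K‖ + costMax T X₀ K * (nB T ^ 2 * ‖K‖ + nB T * nA T) / mu X₀

/-- `h¹_het(K)`. -/
noncomputable def hHet1 : ℝ :=
  costMax T X₀ K / sigmaMinQ T *
      (nB T * (nP T K + 4 * nL T K ^ 2 * (nQ T + ‖K‖ ^ 2 * nR T) * nuK T X₀ K ^ 2))
    + 4 * boundE T X₀ K * nuK T X₀ K ^ 2 * nL T K * ‖secondMoment X₀‖

/-- `h²_het(K)`. -/
noncomputable def hHet2 : ℝ :=
  costMax T X₀ K / sigmaMinQ T *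
      (nL T K * nP T K + nB T * nP T K * ‖K‖
        + 4 * ‖K‖ * nL T K ^ 2 * (nQ T + ‖K‖ ^ 2 * nR T) * nuK T X₀ K ^ 2)
    + 4 * boundE T X₀ K * nuK T X₀ K ^ 2 * ‖K‖ * nL T K * ‖secondMoment X₀‖

/-- `h³_het(K)`. -/
noncomputable def hHet3 : ℝ :=
  costMax T X₀ K / sigmaMinQ T * (nB T * nL T K * nuK T X₀ K)

/-- `h⁴_het(K)`. -/
noncomputable def hHet4 : ℝ :=
  costMax T X₀ K / sigmaMinQ T * (‖K‖ + ‖K‖ ^ 2 * nB T * nL T K * nuK T X₀ K)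

end Polynomials

end MetaLQR

/-! For a stabilizing `K` put L = A - BK, let P solve P = Q + KᵀRK + LᵀPL, and let Y be the state
covariance, Y = Σ₀ + LYLᵀ. Then J(K) = tr(PΣ₀), and the gradient is 2EY with E = RK - BᵀPL
(`gradCost_eq`). Half the difference of two gradients is therefore (Eᵢ - Eⱼ)Yᵢ + Eⱼ(Yᵢ - Yⱼ).

All perturbation bounds rest on `norm_le_of_stein`: if P = S + LᵀPL with P ≥ 0 and S ≥ cI, then c ∑
|Lᵗx|² ≤ xᵀPx, so any solution of X = M + LᵀXL has norm at most (‖P‖/c)‖M‖. The difference of two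
P's, or of two Y's, solves such an equation with a source controlled by the differences of the data.
The duality tr(PΣ₀) = tr((Q + KᵀRK)Y) turns the cost into the bounds ‖P‖ ≤ J/μ and ‖Y‖ ≤ J/σ_Q. The
scalar inequality `perturbation_bound_le` then compares the outcome with the stated coefficients. -/

namespace MetaLQR

/-! ### Spectral norm, positive semidefinite matrices and the smallest singular value. -/

section LinearAlgebra

variable {m n : ℕ}

lemma norm_toLp_sq (x : Fin n → ℝ) : ‖WithLp.toLp 2 x‖ ^ 2 = x ⬝ᵥ x := by
  rw [EuclideanSpace.norm_sq_eq]
  simp [dotProduct, pow_two]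

lemma dotProduct_self_nonneg_real (x : Fin n → ℝ) : 0 ≤ x ⬝ᵥ x := by
  rw [← norm_toLp_sq]; positivity

lemma l2_opNorm_transpose (A : Matrix (Fin m) (Fin n) ℝ) : ‖Aᵀ‖ = ‖A‖ := by
  rw [← Matrix.conjTranspose_eq_transpose_of_trivial, Matrix.l2_opNorm_conjTranspose]

/-- The mean of squares replaces the product of norms so that the bound can be summed along two
trajectories without Cauchy–Schwarz. -/
lemma abs_dotProduct_mulVec_le (X : Matrix (Fin n) (Fin n) ℝ) (x y : Fin n → ℝ) :
    |x ⬝ᵥ X *ᵥ y| ≤ ‖X‖ * ((x ⬝ᵥ x + y ⬝ᵥ y) / 2) := by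
  rw [← Matrix.inner_toEuclideanCLM X (WithLp.toLp 2 x) (WithLp.toLp 2 y),
    ← norm_toLp_sq x, ← norm_toLp_sq y]
  set u := WithLp.toLp 2 x
  set v := WithLp.toLp 2 y
  have h1 := abs_real_inner_le_norm u (Matrix.toEuclideanCLM (𝕜 := ℝ) X v)
  have h2 := (Matrix.toEuclideanCLM (𝕜 := ℝ) X).le_opNorm v
  rw [Matrix.l2_opNorm_toEuclideanCLM] at h2
  have h3 := mul_le_mul_of_nonneg_left h2 (norm_nonneg u)
  have h4 : ‖u‖ * ‖v‖ ≤ (‖u‖ ^ 2 + ‖v‖ ^ 2) / 2 := by nlinarith [sq_nonneg (‖u‖ - ‖v‖)]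
  have h5 := mul_le_mul_of_nonneg_left h4 (norm_nonneg X)
  linarith

lemma dotProduct_mulVec_self_le (X : Matrix (Fin n) (Fin n) ℝ) (x : Fin n → ℝ) :
    x ⬝ᵥ X *ᵥ x ≤ ‖X‖ * (x ⬝ᵥ x) := by
  have := (le_abs_self _).trans (abs_dotProduct_mulVec_le X x x)
  linarith

lemma norm_le_of_dotProduct_mulVec_le {X : Matrix (Fin n) (Fin n) ℝ} {c : ℝ} (hc : 0 ≤ c)
    (h : ∀ x y : Fin n → ℝ, x ⬝ᵥ X *ᵥ y ≤ c * ((x ⬝ᵥ x + y ⬝ᵥ y) / 2)) : ‖X‖ ≤ c := by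
  rw [← Matrix.l2_opNorm_toEuclideanCLM]
  refine ContinuousLinearMap.opNorm_le_bound _ hc fun v => ?_
  set w := Matrix.toEuclideanCLM (𝕜 := ℝ) X v with hw
  rcases eq_or_ne w 0 with h0 | h0
  · rw [h0, norm_zero]; positivity
  have hw0 : 0 < ‖w‖ := norm_pos_iff.2 h0
  -- Rescaling w = Xv to the length of v makes the mean of squares equal to the product of norms.
  have h1 := h (WithLp.ofLp ((‖v‖ / ‖w‖) • w)) (WithLp.ofLp v)
  rw [← Matrix.inner_toEuclideanCLM X ((‖v‖ / ‖w‖) • w) v, ← norm_toLp_sq, ← norm_toLp_sq,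
    WithLp.toLp_ofLp, WithLp.toLp_ofLp, ← hw, real_inner_smul_left, real_inner_self_eq_norm_sq,
    norm_smul, norm_div, norm_norm, norm_norm, div_mul_cancel₀ _ hw0.ne'] at h1
  have h2 : ‖v‖ / ‖w‖ * ‖w‖ ^ 2 = ‖v‖ * ‖w‖ := by field_simp
  rw [h2] at h1
  rcases eq_or_ne v 0 with h3 | h3
  · rw [hw, h3, map_zero] at h0
    exact absurd rfl h0
  have hv : 0 < ‖v‖ := norm_pos_iff.2 h3
  exact le_of_mul_le_mul_left (by nlinarith) hv

lemma PosSemidef.quadratic_nonneg {X : Matrix (Fin n) (Fin n) ℝ} (hX : X.PosSemidef)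
    (x : Fin n → ℝ) : 0 ≤ x ⬝ᵥ X *ᵥ x := by
  simpa using hX.dotProduct_mulVec_nonneg x

lemma dotProduct_mulVec_comm {X : Matrix (Fin n) (Fin n) ℝ} (hX : Xᵀ = X)
    (x y : Fin n → ℝ) : x ⬝ᵥ X *ᵥ y = y ⬝ᵥ X *ᵥ x := by
  rw [Matrix.dotProduct_mulVec, dotProduct_comm, ← Matrix.mulVec_transpose, hX]

lemma PosSemidef.transpose_eq {X : Matrix (Fin n) (Fin n) ℝ} (hX : X.PosSemidef) : Xᵀ = X := by
  rw [← Matrix.conjTranspose_eq_transpose_of_trivial]; exact hX.1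

lemma posSemidef_of_transpose_eq {X : Matrix (Fin n) (Fin n) ℝ} (hX : Xᵀ = X)
    (h : ∀ x, 0 ≤ x ⬝ᵥ X *ᵥ x) : X.PosSemidef := by
  refine .of_dotProduct_mulVec_nonneg ?_ fun x => by simpa using h x
  rw [Matrix.IsHermitian, Matrix.conjTranspose_eq_transpose_of_trivial, hX]

/-- Nonnegativity of the form at x - y bounds the bilinear form by the mean of its diagonal values.
-/
lemma PosSemidef.norm_le {X : Matrix (Fin n) (Fin n) ℝ} (hX : X.PosSemidef) {c : ℝ} (hc : 0 ≤ c)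
    (h : ∀ x, x ⬝ᵥ X *ᵥ x ≤ c * (x ⬝ᵥ x)) : ‖X‖ ≤ c := by
  refine norm_le_of_dotProduct_mulVec_le hc fun x y => ?_
  have h1 := PosSemidef.quadratic_nonneg hX (x - y)
  rw [Matrix.mulVec_sub, sub_dotProduct, dotProduct_sub, dotProduct_sub,
    dotProduct_mulVec_comm (PosSemidef.transpose_eq hX) y x] at h1
  linarith [h x, h y]

lemma PosSemidef.trace_mul_nonneg {S X : Matrix (Fin n) (Fin n) ℝ} (hS : S.PosSemidef)
    (hX : X.PosSemidef) : 0 ≤ (S * X).trace := by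
  obtain ⟨C, rfl⟩ : ∃ C : Matrix (Fin n) (Fin n) ℝ, X = C * Cᴴ := by
    open scoped MatrixOrder in
    obtain ⟨C, hC⟩ := CStarAlgebra.nonneg_iff_eq_star_mul_self.mp (Matrix.nonneg_iff_posSemidef.2 hX)
    exact ⟨Cᴴ, by rw [hC, Matrix.conjTranspose_conjTranspose]; rfl⟩
  rw [← Matrix.mul_assoc, Matrix.trace_mul_comm, ← Matrix.mul_assoc]
  exact (hS.conjTranspose_mul_mul_same C).trace_nonneg

lemma quadratic_sub_smul_one (S : Matrix (Fin n) (Fin n) ℝ) (c : ℝ) (x : Fin n → ℝ) :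
    x ⬝ᵥ (S - c • (1 : Matrix (Fin n) (Fin n) ℝ)) *ᵥ x = x ⬝ᵥ S *ᵥ x - c * (x ⬝ᵥ x) := by
  rw [Matrix.sub_mulVec, dotProduct_sub, Matrix.smul_mulVec, Matrix.one_mulVec, dotProduct_smul,
    smul_eq_mul]

/-- If `S ≥ c I` and `X ≥ 0` then `c ‖X‖ ≤ tr (S X)`. -/
lemma mul_norm_le_trace {S X : Matrix (Fin n) (Fin n) ℝ} {c : ℝ} (hc : 0 ≤ c)
    (hS : (S - c • (1 : Matrix (Fin n) (Fin n) ℝ)).PosSemidef) (hX : X.PosSemidef) :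
    c * ‖X‖ ≤ (S * X).trace := by
  have h1 := PosSemidef.trace_mul_nonneg hS hX
  rw [Matrix.sub_mul, Matrix.trace_sub, Matrix.smul_mul, Matrix.one_mul, Matrix.trace_smul,
    smul_eq_mul] at h1
  have h2 : ‖X‖ ≤ X.trace := by
    refine PosSemidef.norm_le hX hX.trace_nonneg fun x => ?_
    -- Cauchy–Schwarz in the form xxᵀ ≤ |x|² I; pairing it with X under the trace gives xᵀXx ≤ |x|²
    -- tr X.
    have h3 : ((x ⬝ᵥ x) • (1 : Matrix (Fin n) (Fin n) ℝ) - Matrix.vecMulVec x x).PosSemidef := by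
      refine posSemidef_of_transpose_eq ?_ fun y => ?_
      · rw [Matrix.transpose_sub, Matrix.transpose_smul, Matrix.transpose_one,
          Matrix.transpose_vecMulVec]
      · rw [Matrix.sub_mulVec, dotProduct_sub, Matrix.smul_mulVec, Matrix.one_mulVec,
          dotProduct_smul, smul_eq_mul, Matrix.vecMulVec_mulVec]
        rw [op_smul_eq_smul, dotProduct_smul, smul_eq_mul]
        rw [← norm_toLp_sq, ← norm_toLp_sq, dotProduct_comm y x]
        have h4 := abs_real_inner_le_norm (WithLp.toLp 2 x) (WithLp.toLp 2 y)
        have h5 : inner ℝ (WithLp.toLp 2 x) (WithLp.toLp 2 y) = x ⬝ᵥ y := by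
          rw [EuclideanSpace.inner_toLp_toLp, dotProduct_comm]; simp
        rw [h5] at h4
        nlinarith [abs_nonneg (x ⬝ᵥ y), sq_abs (x ⬝ᵥ y)]
    have h4 := PosSemidef.trace_mul_nonneg h3 hX
    rw [Matrix.sub_mul, Matrix.trace_sub, Matrix.smul_mul, Matrix.one_mul, Matrix.trace_smul,
      smul_eq_mul, Matrix.trace_mul_comm, Matrix.mul_vecMulVec, Matrix.trace_vecMulVec,
      dotProduct_comm (X *ᵥ x)] at h4
    linarith
  nlinarith [mul_le_mul_of_nonneg_left h2 hc]

lemma sigmaMin_nonneg (S : Matrix (Fin n) (Fin n) ℝ) : 0 ≤ sigmaMin S :=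
  LinearMap.singularValues_nonneg _ _

lemma sigmaMin_pos {S : Matrix (Fin n) (Fin n) ℝ} (hS : S.PosDef) (hn : 0 < n) :
    0 < sigmaMin S := by
  have hinj : Function.Injective (Matrix.toEuclideanLin S) := by
    have := Matrix.mulVec_injective_of_isUnit hS.isUnit
    intro x y hxy
    apply WithLp.ofLp_injective 2
    apply this
    simpa [Matrix.toLpLin_apply] using hxy
  rw [LinearMap.injective_iff_forall_lt_finrank_singularValues_pos] at hinj
  exact hinj _ (by simpa using hn)

/-- Expand v in an eigenbasis of S*S, whose eigenvalues are the squared singular values. -/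
lemma sigmaMin_mul_norm_le (S : Matrix (Fin n) (Fin n) ℝ) (v : EuclideanSpace ℝ (Fin n)) :
    sigmaMin S * ‖v‖ ≤ ‖Matrix.toEuclideanLin S v‖ := by
  set A := Matrix.toEuclideanLin S with hA
  have hsym := A.isSymmetric_adjoint_comp_self
  have hfin : Module.finrank ℝ (EuclideanSpace ℝ (Fin n)) = n := by simp
  have hle : ∀ i : Fin n, sigmaMin S ^ 2 ≤ hsym.eigenvalues hfin i := fun i => by
    rw [← A.sq_singularValues_fin hfin i]
    exact pow_le_pow_left₀ (sigmaMin_nonneg S) (A.singularValues_antitone (by omega)) 2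
  have h1 : ‖A v‖ ^ 2 = ∑ i, hsym.eigenvalues hfin i *
      (hsym.eigenvectorBasis hfin).repr v i ^ 2 := by
    rw [← real_inner_self_eq_norm_sq, ← LinearMap.adjoint_inner_right, ← LinearMap.comp_apply,
      ← (hsym.eigenvectorBasis hfin).repr.inner_map_map]
    simp only [PiLp.inner_apply, hsym.eigenvectorBasis_apply_self_apply]
    exact Finset.sum_congr rfl fun i _ => by simp; ring
  have h2 : ‖v‖ ^ 2 = ∑ i, (hsym.eigenvectorBasis hfin).repr v i ^ 2 := by
    rw [← (hsym.eigenvectorBasis hfin).repr.norm_map, EuclideanSpace.norm_sq_eq]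
    simp
  refine le_of_sq_le_sq ?_ (norm_nonneg _)
  rw [mul_pow, h1, h2, Finset.mul_sum]
  exact Finset.sum_le_sum fun i _ => mul_le_mul_of_nonneg_right (hle i) (sq_nonneg _)

/-- A unit eigenvector of S - cI with eigenvalue λ satisfies Sv = (λ + c)v. Positivity gives λ + c =
|Sv| ≥ σ_min(S) ≥ c. -/
lemma PosDef.sub_smul_one {S : Matrix (Fin n) (Fin n) ℝ} (hS : S.PosDef) {c : ℝ}
    (hc : c ≤ sigmaMin S) : (S - c • (1 : Matrix (Fin n) (Fin n) ℝ)).PosSemidef := by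
  have hH : (S - c • (1 : Matrix (Fin n) (Fin n) ℝ)).IsHermitian := by
    refine hS.1.sub ?_
    rw [Matrix.IsHermitian, Matrix.conjTranspose_smul, Matrix.conjTranspose_one, star_trivial]
  rw [hH.posSemidef_iff_eigenvalues_nonneg]
  intro i
  set v := hH.eigenvectorBasis i with hv
  have hv1 : ‖v‖ = 1 := hH.eigenvectorBasis.orthonormal.1 i
  have h1 := hH.mulVec_eigenvectorBasis i
  rw [← hv, Matrix.sub_mulVec, Matrix.smul_mulVec, Matrix.one_mulVec, sub_eq_iff_eq_add,
    ← add_smul] at h1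
  have hvv : WithLp.ofLp v ⬝ᵥ WithLp.ofLp v = 1 := by
    rw [← norm_toLp_sq, WithLp.toLp_ofLp, hv1, one_pow]
  have h2 : 0 ≤ hH.eigenvalues i + c := by
    have := PosSemidef.quadratic_nonneg hS.posSemidef (WithLp.ofLp v)
    rwa [h1, dotProduct_smul, hvv, smul_eq_mul, mul_one] at this
  have h3 := sigmaMin_mul_norm_le S v
  have h4 : Matrix.toEuclideanLin S v = (hH.eigenvalues i + c) • v := by
    apply WithLp.ofLp_injective 2
    simpa [Matrix.toLpLin_apply] using h1
  rw [h4, norm_smul, hv1, mul_one, mul_one, Real.norm_of_nonneg h2] at h3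
  simp only [Pi.zero_apply]
  linarith

end LinearAlgebra

/-! ### Stein equations X = M + LᵀXL. -/

section Stein

open Filter Topology

variable {n : ℕ} {L P S X M : Matrix (Fin n) (Fin n) ℝ} {c : ℝ}

lemma stein_telescope (hX : X = M + Lᵀ * X * L) (x y : Fin n → ℝ) (k : ℕ) :
    x ⬝ᵥ X *ᵥ y = ∑ t ∈ Finset.range k, (L ^ t *ᵥ x) ⬝ᵥ M *ᵥ (L ^ t *ᵥ y)
      + (L ^ k *ᵥ x) ⬝ᵥ X *ᵥ (L ^ k *ᵥ y) := by
  have step : ∀ u v : Fin n → ℝ,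
      u ⬝ᵥ X *ᵥ v = u ⬝ᵥ M *ᵥ v + (L *ᵥ u) ⬝ᵥ X *ᵥ (L *ᵥ v) := fun u v => by
    conv_lhs => rw [hX]
    rw [Matrix.add_mulVec, dotProduct_add, ← Matrix.mulVec_mulVec, ← Matrix.mulVec_mulVec,
      Matrix.dotProduct_mulVec u Lᵀ, Matrix.vecMul_transpose]
  induction k with
  | zero => simp
  | succ k ih =>
    rw [ih, Finset.sum_range_succ, step (L ^ k *ᵥ x), pow_succ', ← Matrix.mulVec_mulVec,
      ← Matrix.mulVec_mulVec, add_assoc]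

/-- P acts as a Lyapunov certificate: telescoping bounds the energy of every trajectory with an
explicit constant, without reference to the spectral radius. -/
lemma stein_energy_le (hc : 0 < c) (hP : P.PosSemidef)
    (hS : (S - c • (1 : Matrix (Fin n) (Fin n) ℝ)).PosSemidef) (hPS : P = S + Lᵀ * P * L)
    (x : Fin n → ℝ) (k : ℕ) :
    ∑ t ∈ Finset.range k, (L ^ t *ᵥ x) ⬝ᵥ (L ^ t *ᵥ x) ≤ ‖P‖ / c * (x ⬝ᵥ x) := by
  have h1 := stein_telescope hPS x x k
  have h2 : ∑ t ∈ Finset.range k, c * ((L ^ t *ᵥ x) ⬝ᵥ (L ^ t *ᵥ x)) ≤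
      ∑ t ∈ Finset.range k, (L ^ t *ᵥ x) ⬝ᵥ S *ᵥ (L ^ t *ᵥ x) :=
    Finset.sum_le_sum fun t _ => by
      have := PosSemidef.quadratic_nonneg hS (L ^ t *ᵥ x)
      rw [quadratic_sub_smul_one] at this
      linarith
  rw [← Finset.mul_sum] at h2
  have h3 := PosSemidef.quadratic_nonneg hP (L ^ k *ᵥ x)
  have h4 := dotProduct_mulVec_self_le P x
  rw [div_mul_eq_mul_div, le_div_iff₀ hc]
  linarith

lemma stein_tendsto_zero (hc : 0 < c) (hP : P.PosSemidef)
    (hS : (S - c • (1 : Matrix (Fin n) (Fin n) ℝ)).PosSemidef) (hPS : P = S + Lᵀ * P * L)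
    (x : Fin n → ℝ) :
    Tendsto (fun k => (L ^ k *ᵥ x) ⬝ᵥ (L ^ k *ᵥ x)) atTop (𝓝 0) :=
  (summable_of_sum_range_le (fun _ => dotProduct_self_nonneg_real _)
    (stein_energy_le hc hP hS hPS x)).tendsto_atTop_zero

lemma stein_remainder_tendsto_zero (hc : 0 < c) (hP : P.PosSemidef)
    (hS : (S - c • (1 : Matrix (Fin n) (Fin n) ℝ)).PosSemidef) (hPS : P = S + Lᵀ * P * L)
    (X : Matrix (Fin n) (Fin n) ℝ) (x y : Fin n → ℝ) :
    Tendsto (fun k => (L ^ k *ᵥ x) ⬝ᵥ X *ᵥ (L ^ k *ᵥ y)) atTop (𝓝 0) := by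
  refine squeeze_zero_norm (fun k => abs_dotProduct_mulVec_le X _ _) ?_
  simpa using (((stein_tendsto_zero hc hP hS hPS x).add
    (stein_tendsto_zero hc hP hS hPS y)).div_const 2).const_mul ‖X‖

/-- The solution of a Stein equation is controlled by its inhomogeneity. -/
lemma norm_le_of_stein (hc : 0 < c) (hP : P.PosSemidef)
    (hS : (S - c • (1 : Matrix (Fin n) (Fin n) ℝ)).PosSemidef) (hPS : P = S + Lᵀ * P * L)
    (hX : X = M + Lᵀ * X * L) : ‖X‖ ≤ ‖P‖ / c * ‖M‖ := by
  refine norm_le_of_dotProduct_mulVec_le (by positivity) fun x y => ?_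
  -- The remainder of the telescoped identity has no sign, so it is removed by passing to the limit.
  have hlim : Tendsto (fun k => ‖P‖ / c * ‖M‖ * ((x ⬝ᵥ x + y ⬝ᵥ y) / 2)
      + (L ^ k *ᵥ x) ⬝ᵥ X *ᵥ (L ^ k *ᵥ y)) atTop
      (𝓝 (‖P‖ / c * ‖M‖ * ((x ⬝ᵥ x + y ⬝ᵥ y) / 2) + 0)) :=
    tendsto_const_nhds.add (stein_remainder_tendsto_zero hc hP hS hPS X x y)
  rw [add_zero] at hlim
  refine ge_of_tendsto' hlim fun k => ?_
  rw [stein_telescope hX x y k]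
  gcongr
  calc ∑ t ∈ Finset.range k, (L ^ t *ᵥ x) ⬝ᵥ M *ᵥ (L ^ t *ᵥ y)
      ≤ ∑ t ∈ Finset.range k, ‖M‖ * (((L ^ t *ᵥ x) ⬝ᵥ (L ^ t *ᵥ x)
          + (L ^ t *ᵥ y) ⬝ᵥ (L ^ t *ᵥ y)) / 2) :=
        Finset.sum_le_sum fun t _ => (le_abs_self _).trans (abs_dotProduct_mulVec_le _ _ _)
    _ = ‖M‖ * ((∑ t ∈ Finset.range k, (L ^ t *ᵥ x) ⬝ᵥ (L ^ t *ᵥ x)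
          + ∑ t ∈ Finset.range k, (L ^ t *ᵥ y) ⬝ᵥ (L ^ t *ᵥ y)) / 2) := by
        rw [← Finset.mul_sum, ← Finset.sum_div, Finset.sum_add_distrib]
    _ ≤ ‖M‖ * ((‖P‖ / c * (x ⬝ᵥ x) + ‖P‖ / c * (y ⬝ᵥ y)) / 2) := by
        gcongr
        · exact stein_energy_le hc hP hS hPS x k
        · exact stein_energy_le hc hP hS hPS y k
    _ = _ := by ring

lemma hasSum_of_stein (hc : 0 < c) (hP : P.PosSemidef) (hS0 : S.PosSemidef)
    (hS : (S - c • (1 : Matrix (Fin n) (Fin n) ℝ)).PosSemidef) (hPS : P = S + Lᵀ * P * L)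
    (x : Fin n → ℝ) :
    HasSum (fun t => (L ^ t *ᵥ x) ⬝ᵥ S *ᵥ (L ^ t *ᵥ x)) (x ⬝ᵥ P *ᵥ x) := by
  rw [hasSum_iff_tendsto_nat_of_nonneg fun t => PosSemidef.quadratic_nonneg hS0 _]
  have := (tendsto_const_nhds (x := x ⬝ᵥ P *ᵥ x)).sub
    (stein_remainder_tendsto_zero hc hP hS hPS P x x)
  rw [sub_zero] at this
  exact this.congr fun k => by rw [stein_telescope hPS x x k]; ring

/-- The solution is the series ∑ (Lᵗ)ᵀ S Lᵗ; splitting off its first term gives the equation. -/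
lemma exists_stein (hL : Summable fun t => ‖L ^ t‖ ^ 2) (hS : S.PosSemidef) :
    ∃ P : Matrix (Fin n) (Fin n) ℝ, P.PosSemidef ∧ P = S + Lᵀ * P * L := by
  have hsum : Summable fun t => (L ^ t)ᵀ * S * L ^ t := by
    refine Summable.of_norm_bounded (hL.mul_left ‖S‖) fun t => ?_
    calc ‖(L ^ t)ᵀ * S * L ^ t‖ ≤ ‖(L ^ t)ᵀ‖ * ‖S‖ * ‖L ^ t‖ :=
          (norm_mul_le _ _).trans (by gcongr; exact norm_mul_le _ _)
      _ = ‖S‖ * ‖L ^ t‖ ^ 2 := by rw [l2_opNorm_transpose]; ring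
  have hpsd : ∀ t, ((L ^ t)ᵀ * S * L ^ t).PosSemidef := fun t => by
    rw [← Matrix.conjTranspose_eq_transpose_of_trivial]
    exact hS.conjTranspose_mul_mul_same _
  refine ⟨∑' t, (L ^ t)ᵀ * S * L ^ t, ?_, ?_⟩
  · refine posSemidef_of_transpose_eq ?_ fun x => ?_
    · rw [Matrix.transpose_tsum]
      exact tsum_congr fun t => PosSemidef.transpose_eq (hpsd t)
    · let φ : Matrix (Fin n) (Fin n) ℝ →ₗ[ℝ] ℝ :=
        { toFun := fun A => x ⬝ᵥ A *ᵥ x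
          map_add' := fun A B => by rw [Matrix.add_mulVec, dotProduct_add]
          map_smul' := fun r A => by
            rw [Matrix.smul_mulVec, dotProduct_smul, RingHom.id_apply] }
      have h := hsum.hasSum.mapL (LinearMap.toContinuousLinearMap φ)
      exact h.nonneg fun t => PosSemidef.quadratic_nonneg (hpsd t) x
  · conv_lhs => rw [hsum.tsum_eq_zero_add, pow_zero, Matrix.transpose_one, Matrix.one_mul,
      Matrix.mul_one]
    congr 1
    rw [← hsum.tsum_mul_left, ← (hsum.mul_left _).tsum_mul_right]
    · exact tsum_congr fun t => by simp only [pow_succ, Matrix.transpose_mul, Matrix.mul_assoc]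

/-- Duality of the two Stein equations. -/
lemma stein_trace_duality {G H Y : Matrix (Fin n) (Fin n) ℝ} (hX : X = G + Lᵀ * X * L)
    (hY : Y = H + L * Y * Lᵀ) : (X * H).trace = (G * Y).trace := by
  have h1 : H = Y - L * Y * Lᵀ := eq_sub_of_add_eq hY.symm
  have h2 : G = X - Lᵀ * X * L := eq_sub_of_add_eq hX.symm
  rw [h1, h2, Matrix.mul_sub, Matrix.sub_mul, Matrix.trace_sub, Matrix.trace_sub]
  congr 1
  rw [← Matrix.mul_assoc, Matrix.trace_mul_comm]
  simp only [Matrix.mul_assoc]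

end Stein

/-! ### Consequences of spectral radius below one. -/

section Stability

open Filter Topology

variable {n : ℕ}

lemma summable_norm_pow_sq_of_spectralRadius_lt_one {L : Matrix (Fin n) (Fin n) ℝ}
    (hL : spectralRadius ℂ (L.map (algebraMap ℝ ℂ)) < 1) : Summable fun t => ‖L ^ t‖ ^ 2 := by
  let φ : Matrix (Fin n) (Fin n) ℝ →ₐ[ℝ] Matrix (Fin n) (Fin n) ℂ := (Algebra.ofId ℝ ℂ).mapMatrix
  have hinj : Function.Injective φ.toLinearMap := fun A B h => by
    ext i j
    have := congrFun (congrFun h i) j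
    exact (algebraMap ℝ ℂ).injective this
  -- Gelfand's formula controls complex powers; injectivity in finite dimension transfers the decay
  -- to real ones, with a constant independent of the exponent.
  obtain ⟨κ, -, hκ⟩ := φ.toLinearMap.exists_antilipschitzWith (LinearMap.ker_eq_bot.2 hinj)
  have hbd : ∀ A, ‖A‖ ≤ κ * ‖φ A‖ := fun A => by
    simpa using hκ.le_mul_dist A 0
  obtain ⟨r, hr1, hr2⟩ := ENNReal.lt_iff_exists_nnreal_btwn.1 hL
  have hr2' : (r : ℝ) < 1 := by exact_mod_cast hr2
  have hev := (spectrum.pow_nnnorm_pow_one_div_tendsto_nhds_spectralRadius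
    (L.map (algebraMap ℝ ℂ))).eventually_lt_const hr1
  have hev2 : ∀ᶠ t in atTop, ‖‖L ^ t‖ ^ 2‖ ≤ (κ : ℝ) ^ 2 * ((r : ℝ) ^ 2) ^ t := by
    filter_upwards [hev, eventually_gt_atTop 0] with t ht ht0
    have h1 : ‖φ L ^ t‖ ≤ (r : ℝ) ^ t := by
      have h2 : (‖φ L ^ t‖₊ : ENNReal) ≤ (r : ENNReal) ^ t := by
        rw [← ENNReal.rpow_natCast, ← ENNReal.rpow_inv_le_iff (by positivity), ← one_div]
        exact ht.le
      exact_mod_cast h2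
    have h3 : ‖L ^ t‖ ≤ κ * (r : ℝ) ^ t := by
      have := hbd (L ^ t)
      rw [map_pow] at this
      exact this.trans (by gcongr)
    rw [norm_pow, norm_norm, ← pow_mul, mul_comm 2 t, pow_mul, ← mul_pow]
    gcongr
  exact Summable.of_norm_bounded_eventually_nat
    ((summable_geometric_of_lt_one (by positivity) (by nlinarith [r.coe_nonneg])).mul_left _) hev2

/-- By Gelfand's formula some power has norm below one. This is an open condition, and it bounds the
spectral radius. -/
lemma isOpen_spectralRadius_lt_one :
    IsOpen {L : Matrix (Fin n) (Fin n) ℝ | spectralRadius ℂ (L.map (algebraMap ℝ ℂ)) < 1} := by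
  rw [isOpen_iff_mem_nhds]
  intro L hL
  have hev := (spectrum.pow_nnnorm_pow_one_div_tendsto_nhds_spectralRadius
    (L.map (algebraMap ℝ ℂ))).eventually_lt_const hL
  obtain ⟨t, ht, ht0⟩ := (hev.and (eventually_gt_atTop 0)).exists
  obtain ⟨k, rfl⟩ := Nat.exists_eq_succ_of_ne_zero ht0.ne'
  have hlt : ‖(L.map (algebraMap ℝ ℂ)) ^ (k + 1)‖₊ < 1 := by
    rw [one_div, ENNReal.rpow_inv_lt_iff (by positivity), ENNReal.one_rpow] at ht
    exact_mod_cast ht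
  have hcont : Continuous fun A : Matrix (Fin n) (Fin n) ℝ =>
      ‖(A.map (algebraMap ℝ ℂ)) ^ (k + 1)‖₊ := by
    have : Continuous fun A : Matrix (Fin n) (Fin n) ℝ => A.map (algebraMap ℝ ℂ) :=
      Continuous.matrix_map continuous_id (by simpa using Complex.continuous_ofReal)
    fun_prop
  filter_upwards [hcont.continuousAt.eventually_lt_const hlt] with A hA
  refine (spectrum.spectralRadius_le_pow_nnnorm_pow_one_div ℂ _ k).trans_lt ?_
  -- The bound carries a factor ‖1‖, which is 0 in dimension zero and 1 otherwise.
  rcases isEmpty_or_nonempty (Fin n) with h | h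
  · have h0 : ‖(1 : Matrix (Fin n) (Fin n) ℂ)‖₊ = 0 := by
      rw [Subsingleton.elim (1 : Matrix (Fin n) (Fin n) ℂ) 0, nnnorm_zero]
    rw [h0, ENNReal.coe_zero, ENNReal.zero_rpow_of_pos (by positivity), mul_zero]
    exact one_pos
  · have h1 : ‖(1 : Matrix (Fin n) (Fin n) ℂ)‖₊ = 1 := nnnorm_one
    rw [h1, ENNReal.coe_one, ENNReal.one_rpow, mul_one]
    exact ENNReal.rpow_lt_one (by exact_mod_cast hA) (by positivity)

end Stability

/-! ### Trace formula for the cost and its gradient. -/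

lemma exists_pos_sub_smul_one {n : ℕ} {S : Matrix (Fin n) (Fin n) ℝ} (hS : S.PosDef) :
    ∃ c : ℝ, 0 < c ∧ (S - c • (1 : Matrix (Fin n) (Fin n) ℝ)).PosSemidef := by
  rcases Nat.eq_zero_or_pos n with rfl | hn
  · exact ⟨1, one_pos, by
      rw [Subsingleton.elim (S - (1 : ℝ) • (1 : Matrix (Fin 0) (Fin 0) ℝ)) S]
      exact hS.posSemidef⟩
  · exact ⟨_, sigmaMin_pos hS hn, PosDef.sub_smul_one hS le_rfl⟩

lemma integral_quadratic_eq_trace {nx : ℕ} {X₀ : Measure (Fin nx → ℝ)}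
    (hX₀ : ∀ k, MemLp (fun x : Fin nx → ℝ => x k) 2 X₀) (P : Matrix (Fin nx) (Fin nx) ℝ) :
    ∫ x, x ⬝ᵥ P *ᵥ x ∂X₀ = (P * secondMoment X₀).trace := by
  have hint : ∀ k l, Integrable (fun x : Fin nx → ℝ => x k * x l) X₀ := fun k l =>
    (hX₀ k).integrable_mul (hX₀ l)
  have h1 : ∀ x : Fin nx → ℝ, x ⬝ᵥ P *ᵥ x = ∑ k, ∑ l, P k l * (x l * x k) := fun x => by
    simp only [dotProduct, Matrix.mulVec, Finset.mul_sum]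
    exact Finset.sum_congr rfl fun k _ => Finset.sum_congr rfl fun l _ => by ring
  simp_rw [h1]
  refine (integral_finsetSum _ fun k _ =>
    integrable_finsetSum _ fun l _ => (hint l k).const_mul _).trans ?_
  simp only [Matrix.trace, Matrix.diag, Matrix.mul_apply, secondMoment, Matrix.of_apply]
  refine Finset.sum_congr rfl fun k _ => ?_
  refine (integral_finsetSum _ fun l _ => (hint l k).const_mul _).trans ?_
  exact Finset.sum_congr rfl fun l _ => integral_const_mul _ _

lemma exists_abs_trace_le (n : ℕ) :
    ∃ C : ℝ, 0 ≤ C ∧ ∀ X : Matrix (Fin n) (Fin n) ℝ, |X.trace| ≤ C * ‖X‖ := by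
  let φ := LinearMap.toContinuousLinearMap (Matrix.traceLinearMap (Fin n) ℝ ℝ)
  exact ⟨‖φ‖, φ.opNorm_nonneg, fun X => φ.le_opNorm X⟩

namespace LQRTask

open Filter Topology Asymptotics

variable {nx nu : ℕ} {T : LQRTask nx nu} {X₀ : Measure (Fin nx → ℝ)}
  {K : Matrix (Fin nu) (Fin nx) ℝ}

lemma state_eq (T : LQRTask nx nu) (K : Matrix (Fin nu) (Fin nx) ℝ) (x : Fin nx → ℝ) (t : ℕ) :
    T.state K x t = T.closedLoop K ^ t *ᵥ x := by
  induction t with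
  | zero => simp [state]
  | succ t ih =>
    rw [state, ih, pow_succ', ← Matrix.mulVec_mulVec]
    generalize T.closedLoop K ^ t *ᵥ x = y
    rw [closedLoop, Matrix.sub_mulVec, Matrix.mulVec_neg, ← Matrix.mulVec_mulVec y T.B,
      sub_eq_add_neg]

lemma posSemidef_transpose_mul_R_mul (T : LQRTask nx nu) (K : Matrix (Fin nu) (Fin nx) ℝ) :
    (Kᵀ * T.R * K).PosSemidef := by
  rw [← Matrix.conjTranspose_eq_transpose_of_trivial]
  exact T.posDef_R.posSemidef.conjTranspose_mul_mul_same K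

lemma posDef_stageCost (T : LQRTask nx nu) (K : Matrix (Fin nu) (Fin nx) ℝ) :
    (T.stageCost K).PosDef :=
  T.posDef_Q.add_posSemidef (T.posSemidef_transpose_mul_R_mul K)

lemma stageCost_sub_smul_one (T : LQRTask nx nu) (K : Matrix (Fin nu) (Fin nx) ℝ) {c : ℝ}
    (hc : c ≤ sigmaMin T.Q) :
    (T.stageCost K - c • (1 : Matrix (Fin nx) (Fin nx) ℝ)).PosSemidef := by
  have := (PosDef.sub_smul_one T.posDef_Q hc).add (T.posSemidef_transpose_mul_R_mul K)
  rwa [sub_add_eq_add_sub] at this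

lemma cost_eq_trace (hX₀ : ∀ k, MemLp (fun x : Fin nx → ℝ => x k) 2 X₀)
    {P : Matrix (Fin nx) (Fin nx) ℝ} (hP : P.PosSemidef)
    (hPS : P = T.stageCost K + (T.closedLoop K)ᵀ * P * T.closedLoop K) :
    T.cost X₀ K = (P * secondMoment X₀).trace := by
  obtain ⟨c, hc, hS⟩ := exists_pos_sub_smul_one (T.posDef_stageCost K)
  rw [← integral_quadratic_eq_trace hX₀, cost]
  congr 1 with x
  simp_rw [state_eq]
  exact (hasSum_of_stein hc hP (T.posDef_stageCost K).posSemidef hS hPS x).tsum_eq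

lemma IsStabilizing.summable (hK : T.IsStabilizing K) :
    Summable fun t => ‖T.closedLoop K ^ t‖ ^ 2 :=
  summable_norm_pow_sq_of_spectralRadius_lt_one hK

/-- Existence is what gives meaning to the choice in `lyapunov`. Uniqueness is not needed, since
later lemmas accept any solution. -/
lemma IsStabilizing.isLyapunovSolution_lyapunov (hK : T.IsStabilizing K) :
    T.IsLyapunovSolution K (T.lyapunov K) := by
  obtain ⟨P, hP, hPS⟩ := exists_stein hK.summable (T.posDef_stageCost K).posSemidef
  refine Classical.epsilon_spec (p := T.IsLyapunovSolution K) ⟨P, ?_, hPS⟩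
  rw [hPS]
  refine (T.posDef_stageCost K).add_posSemidef ?_
  rw [← Matrix.conjTranspose_eq_transpose_of_trivial]
  exact hP.conjTranspose_mul_mul_same _

/-- The stationary state covariance `Σ = Σ₀ + (A - B K) Σ (A - B K)ᵀ` exists. -/
lemma IsStabilizing.exists_covariance (hK : T.IsStabilizing K)
    {H : Matrix (Fin nx) (Fin nx) ℝ} (hH : H.PosSemidef) :
    ∃ Y : Matrix (Fin nx) (Fin nx) ℝ, Y.PosSemidef ∧
      Y = H + T.closedLoop K * Y * (T.closedLoop K)ᵀ := by
  have h : Summable fun t => ‖(T.closedLoop K)ᵀ ^ t‖ ^ 2 := by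
    simpa only [← Matrix.transpose_pow, l2_opNorm_transpose] using hK.summable
  simpa only [Matrix.transpose_transpose] using exists_stein h hH

lemma eventually_isStabilizing (hK : T.IsStabilizing K) : ∀ᶠ K' in 𝓝 K, T.IsStabilizing K' := by
  have hcont : Continuous T.closedLoop := by
    unfold closedLoop
    fun_prop
  exact (isOpen_spectralRadius_lt_one.preimage hcont).mem_nhds hK

/-- `E_K = R K - Bᵀ P (A - B K)`; the gradient of the cost is `2 E_K Σ_K`. -/
def gradFactor (T : LQRTask nx nu) (K : Matrix (Fin nu) (Fin nx) ℝ)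
    (P : Matrix (Fin nx) (Fin nx) ℝ) : Matrix (Fin nu) (Fin nx) ℝ :=
  T.R * K - T.Bᵀ * P * T.closedLoop K

/-- With P frozen, the right side of the Lyapunov equation is quadratic in the controller; this is
its exact expansion at `K`, where it equals P. -/
lemma stageCost_add_conj_sub {P : Matrix (Fin nx) (Fin nx) ℝ} (hP : Pᵀ = P)
    (hPS : P = T.stageCost K + (T.closedLoop K)ᵀ * P * T.closedLoop K)
    (K' : Matrix (Fin nu) (Fin nx) ℝ) :
    T.stageCost K' + (T.closedLoop K')ᵀ * P * T.closedLoop K' - P =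
      (K' - K)ᵀ * T.gradFactor K P + (T.gradFactor K P)ᵀ * (K' - K)
        + (K' - K)ᵀ * (T.R + T.Bᵀ * P * T.B) * (K' - K) := by
  have hR : T.Rᵀ = T.R := PosSemidef.transpose_eq T.posDef_R.posSemidef
  obtain ⟨D, rfl⟩ : ∃ D, K' = K + D := ⟨K' - K, by abel⟩
  have hL : T.closedLoop (K + D) = T.closedLoop K - T.B * D := by
    rw [closedLoop, closedLoop, Matrix.mul_add]; abel
  conv_lhs => rw [sub_eq_add_neg]; arg 2; rw [hPS]
  rw [hL, add_sub_cancel_left, gradFactor]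
  generalize T.closedLoop K = L
  simp only [stageCost, Matrix.transpose_add, Matrix.transpose_sub,
    Matrix.transpose_mul, Matrix.transpose_transpose, hP, hR, Matrix.mul_add, Matrix.add_mul,
    Matrix.mul_sub, Matrix.sub_mul, Matrix.mul_assoc]
  abel

/-- P' - P solves the Stein equation of the new closed loop, with the defect of P as source. Duality
pairs that defect with the new covariance Y', so the identity is exact. -/
lemma cost_sub_cost (hX₀ : ∀ k, MemLp (fun x : Fin nx → ℝ => x k) 2 X₀)
    {P Y' : Matrix (Fin nx) (Fin nx) ℝ} (hP : P.PosSemidef)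
    (hPS : P = T.stageCost K + (T.closedLoop K)ᵀ * P * T.closedLoop K)
    {K' : Matrix (Fin nu) (Fin nx) ℝ} (hK' : T.IsStabilizing K') (hY' : Y'.PosSemidef)
    (hYS' : Y' = secondMoment X₀ + T.closedLoop K' * Y' * (T.closedLoop K')ᵀ) :
    T.cost X₀ K' - T.cost X₀ K = 2 * ((K' - K)ᵀ * (T.gradFactor K P * Y')).trace
      + ((K' - K)ᵀ * ((T.R + T.Bᵀ * P * T.B) * (K' - K) * Y')).trace := by
  obtain ⟨hP', hPS'⟩ := hK'.isLyapunovSolution_lyapunov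
  set P' := T.lyapunov K'
  rw [cost_eq_trace hX₀ hP'.posSemidef hPS', cost_eq_trace hX₀ hP hPS, ← Matrix.trace_sub,
    ← Matrix.sub_mul]
  have h1 : P' - P = (T.stageCost K' + (T.closedLoop K')ᵀ * P * T.closedLoop K' - P)
      + (T.closedLoop K')ᵀ * (P' - P) * T.closedLoop K' := by
    conv_lhs => rw [hPS']
    rw [Matrix.mul_sub, Matrix.sub_mul]
    abel
  rw [stein_trace_duality h1 hYS', stageCost_add_conj_sub (PosSemidef.transpose_eq hP) hPS,
    Matrix.add_mul, Matrix.add_mul, Matrix.trace_add, Matrix.trace_add, two_mul]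
  congr 1
  · congr 1
    · rw [Matrix.mul_assoc]
    · rw [← Matrix.trace_transpose, Matrix.transpose_mul, Matrix.transpose_mul,
        Matrix.transpose_transpose, PosSemidef.transpose_eq hY', Matrix.trace_mul_comm,
        Matrix.mul_assoc]
  · simp only [Matrix.mul_assoc]

/-- Stein-equation perturbation bound for the stationary covariance. -/
lemma norm_covariance_sub_le {n : ℕ} {L L' H Y Y' : Matrix (Fin n) (Fin n) ℝ} {c : ℝ} (hc : 0 < c)
    (hH : (H - c • (1 : Matrix (Fin n) (Fin n) ℝ)).PosSemidef) (hY : Y.PosSemidef)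
    (hYS : Y = H + L * Y * Lᵀ) (hYS' : Y' = H + L' * Y' * L'ᵀ) :
    ‖Y' - Y‖ ≤ ‖Y‖ / c * ((‖L‖ + ‖L'‖) * ‖L' - L‖ * ‖Y'‖) := by
  have h1 : Y' - Y = (L * Y' * (L' - L)ᵀ + (L' - L) * Y' * L'ᵀ) + (Lᵀ)ᵀ * (Y' - Y) * Lᵀ := by
    conv_lhs => rw [hYS, hYS']
    rw [Matrix.transpose_transpose, Matrix.transpose_sub]
    noncomm_ring
  have h2 : Y = H + (Lᵀ)ᵀ * Y * Lᵀ := by rwa [Matrix.transpose_transpose]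
  refine (norm_le_of_stein hc hY hH h2 h1).trans ?_
  gcongr
  calc ‖L * Y' * (L' - L)ᵀ + (L' - L) * Y' * L'ᵀ‖
      ≤ ‖L‖ * ‖Y'‖ * ‖L' - L‖ + ‖L' - L‖ * ‖Y'‖ * ‖L'‖ := by
        refine (norm_add_le _ _).trans (add_le_add ?_ ?_)
        · rw [← l2_opNorm_transpose (L' - L)]
          exact (norm_mul_le _ _).trans (by gcongr; exact norm_mul_le _ _)
        · rw [← l2_opNorm_transpose L']
          exact (norm_mul_le _ _).trans (by gcongr; exact norm_mul_le _ _)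
    _ = _ := by ring

/-- The differential of the cost: `D ↦ 2 tr (Dᵀ E Σ)`. -/
noncomputable def costDifferential (E : Matrix (Fin nu) (Fin nx) ℝ)
    (Y : Matrix (Fin nx) (Fin nx) ℝ) : Matrix (Fin nu) (Fin nx) ℝ →L[ℝ] ℝ :=
  LinearMap.toContinuousLinearMap
    { toFun := fun D => 2 * (Dᵀ * (E * Y)).trace
      map_add' := fun D D' => by
        rw [Matrix.transpose_add, Matrix.add_mul, Matrix.trace_add, mul_add]
      map_smul' := fun r D => by
        rw [Matrix.transpose_smul, Matrix.smul_mul, Matrix.trace_smul, RingHom.id_apply,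
          smul_eq_mul, smul_eq_mul]
        ring }

lemma costDifferential_apply (E : Matrix (Fin nu) (Fin nx) ℝ) (Y : Matrix (Fin nx) (Fin nx) ℝ)
    (D : Matrix (Fin nu) (Fin nx) ℝ) :
    costDifferential E Y D = 2 * (Dᵀ * (E * Y)).trace := rfl

/-- In `cost_sub_cost`, replacing Y' by Y costs O(‖D‖) against a factor D, so the total error is
O(‖D‖²). -/
theorem hasFDerivAt_cost (hX₀ : ∀ k, MemLp (fun x : Fin nx → ℝ => x k) 2 X₀)
    (hCov : (secondMoment X₀).PosDef) (hK : T.IsStabilizing K)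
    {P Y : Matrix (Fin nx) (Fin nx) ℝ} (hP : P.PosSemidef)
    (hPS : P = T.stageCost K + (T.closedLoop K)ᵀ * P * T.closedLoop K) (hY : Y.PosSemidef)
    (hYS : Y = secondMoment X₀ + T.closedLoop K * Y * (T.closedLoop K)ᵀ) :
    HasFDerivAt (T.cost X₀) (costDifferential (T.gradFactor K P) Y) K := by
  obtain ⟨c, hc, hH⟩ := exists_pos_sub_smul_one hCov
  obtain ⟨C, hC, htr⟩ := exists_abs_trace_le nx
  set E := T.gradFactor K P
  set W := T.R + T.Bᵀ * P * T.B
  -- The constant of `norm_covariance_sub_le` when ‖D‖ < 1, where ‖L'‖ ≤ ‖L‖ + ‖B‖.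
  set q := ‖Y‖ / c * ((2 * ‖T.closedLoop K‖ + ‖T.B‖) * ‖T.B‖) with hq
  have hq0 : 0 ≤ q := by positivity
  have hsmall : ∀ᶠ K' in 𝓝 K, ‖K' - K‖ < 1 ∧ q * ‖K' - K‖ < 1 / 2 := by
    have h0 : Tendsto (fun K' => ‖K' - K‖) (𝓝 K) (𝓝 0) := by
      have : Continuous fun K' : Matrix (Fin nu) (Fin nx) ℝ => ‖K' - K‖ := by fun_prop
      simpa using this.tendsto K
    have h1 := h0.const_mul q
    rw [mul_zero] at h1
    exact (h0.eventually_lt_const one_pos).and (h1.eventually_lt_const (by norm_num))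
  have hO : (fun K' => T.cost X₀ K' - T.cost X₀ K - costDifferential E Y (K' - K))
      =O[𝓝 K] fun K' => ‖K' - K‖ ^ 2 := by
    refine IsBigO.of_bound (C * (4 * ‖E‖ * q * ‖Y‖ + 2 * ‖W‖ * ‖Y‖)) ?_
    filter_upwards [hsmall, eventually_isStabilizing hK] with K' ⟨hs1, hs2⟩ hK'
    obtain ⟨Y', hY', hYS'⟩ := hK'.exists_covariance hCov.posSemidef
    rw [cost_sub_cost hX₀ hP hPS hK' hY' hYS', costDifferential_apply]
    set D := K' - K with hD
    have hL : T.closedLoop K' - T.closedLoop K = -(T.B * D) := by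
      rw [closedLoop, closedLoop, hD, Matrix.mul_sub]; abel
    have hL1 : ‖T.closedLoop K' - T.closedLoop K‖ ≤ ‖T.B‖ * ‖D‖ := by
      rw [hL, norm_neg]; exact Matrix.l2_opNorm_mul _ _
    have hL2 : ‖T.closedLoop K'‖ ≤ ‖T.closedLoop K‖ + ‖T.B‖ := by
      have h1 := norm_add_le (T.closedLoop K) (T.closedLoop K' - T.closedLoop K)
      rw [add_sub_cancel] at h1
      nlinarith [norm_nonneg T.B]
    have hdiff : ‖Y' - Y‖ ≤ q * ‖D‖ * ‖Y'‖ :=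
      calc _ ≤ _ := norm_covariance_sub_le hc hH hY hYS hYS'
        _ ≤ ‖Y‖ / c * ((‖T.closedLoop K‖ + (‖T.closedLoop K‖ + ‖T.B‖)) * (‖T.B‖ * ‖D‖) * ‖Y'‖) := by
          gcongr
        _ = _ := by rw [hq]; ring
    -- Since q‖D‖ < 1/2, the term in ‖Y'‖ is absorbed on the left.
    have hY2 : ‖Y'‖ ≤ 2 * ‖Y‖ := by
      have h1 := norm_add_le Y (Y' - Y)
      rw [add_sub_cancel] at h1
      nlinarith [norm_nonneg Y']
    have hdiff2 : ‖Y' - Y‖ ≤ q * ‖D‖ * (2 * ‖Y‖) := hdiff.trans (by gcongr)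
    have heq : 2 * (Dᵀ * (E * Y')).trace + (Dᵀ * (W * D * Y')).trace - 2 * (Dᵀ * (E * Y)).trace
        = (Dᵀ * ((2 : ℝ) • (E * (Y' - Y)) + W * D * Y')).trace := by
      rw [Matrix.mul_add, Matrix.trace_add, Matrix.mul_smul, Matrix.trace_smul,
        Matrix.mul_sub E, Matrix.mul_sub Dᵀ, Matrix.trace_sub, smul_eq_mul]
      ring
    rw [heq, Real.norm_eq_abs, norm_pow, norm_norm]
    have h1 : ‖(2 : ℝ) • (E * (Y' - Y)) + W * D * Y'‖
        ≤ 2 * (‖E‖ * (q * ‖D‖ * (2 * ‖Y‖))) + ‖W‖ * ‖D‖ * (2 * ‖Y‖) := by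
      refine (norm_add_le _ _).trans (add_le_add ?_ ?_)
      · rw [norm_smul, Real.norm_ofNat]
        gcongr
        exact (Matrix.l2_opNorm_mul _ _).trans (by gcongr)
      · exact (Matrix.l2_opNorm_mul _ _).trans (by
          gcongr
          exact Matrix.l2_opNorm_mul _ _)
    calc _ ≤ C * ‖Dᵀ * ((2 : ℝ) • (E * (Y' - Y)) + W * D * Y')‖ := htr _
      _ ≤ C * (‖D‖ * (2 * (‖E‖ * (q * ‖D‖ * (2 * ‖Y‖))) + ‖W‖ * ‖D‖ * (2 * ‖Y‖))) := by
        gcongr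
        refine (Matrix.l2_opNorm_mul _ _).trans ?_
        rw [l2_opNorm_transpose]
        gcongr
      _ = _ := by ring
  refine HasFDerivAt.of_isLittleO (hO.trans_isLittleO ?_)
  exact isLittleO_pow_sub_sub K one_lt_two

lemma gradCost_eq (hX₀ : ∀ k, MemLp (fun x : Fin nx → ℝ => x k) 2 X₀)
    (hCov : (secondMoment X₀).PosDef) (hK : T.IsStabilizing K)
    {P Y : Matrix (Fin nx) (Fin nx) ℝ} (hP : P.PosSemidef)
    (hPS : P = T.stageCost K + (T.closedLoop K)ᵀ * P * T.closedLoop K) (hY : Y.PosSemidef)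
    (hYS : Y = secondMoment X₀ + T.closedLoop K * Y * (T.closedLoop K)ᵀ) :
    T.gradCost X₀ K = (2 : ℝ) • (T.gradFactor K P * Y) := by
  ext a b
  rw [gradCost, Matrix.of_apply, (hasFDerivAt_cost hX₀ hCov hK hP hPS hY hYS).fderiv,
    costDifferential_apply, Matrix.transpose_single, Matrix.trace_single_mul, one_smul]
  rfl

end LQRTask

/-! ### Bounds by the cost, and perturbation between two tasks. -/

namespace LQRTask

variable {nx nu : ℕ} {T T' : LQRTask nx nu} {X₀ : Measure (Fin nx → ℝ)}
  {K : Matrix (Fin nu) (Fin nx) ℝ} {P P' Y : Matrix (Fin nx) (Fin nx) ℝ}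

lemma cost_nonneg (T : LQRTask nx nu) (X₀ : Measure (Fin nx → ℝ))
    (K : Matrix (Fin nu) (Fin nx) ℝ) : 0 ≤ T.cost X₀ K :=
  integral_nonneg fun _ => tsum_nonneg fun _ =>
    PosSemidef.quadratic_nonneg (T.posDef_stageCost K).posSemidef _

lemma mul_norm_lyapunov_le_cost (hX₀ : ∀ k, MemLp (fun x : Fin nx → ℝ => x k) 2 X₀)
    (hCov : (secondMoment X₀).PosDef) (hP : P.PosSemidef)
    (hPS : P = T.stageCost K + (T.closedLoop K)ᵀ * P * T.closedLoop K) :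
    mu X₀ * ‖P‖ ≤ T.cost X₀ K := by
  rw [cost_eq_trace hX₀ hP hPS, Matrix.trace_mul_comm]
  exact mul_norm_le_trace (sigmaMin_nonneg _) (PosDef.sub_smul_one hCov le_rfl) hP

/-- By duality the cost is also tr((Q + KᵀRK)Y), and Q + KᵀRK ≥ Q ≥ cI. -/
lemma mul_norm_covariance_le_cost (hX₀ : ∀ k, MemLp (fun x : Fin nx → ℝ => x k) 2 X₀)
    (hP : P.PosSemidef) (hPS : P = T.stageCost K + (T.closedLoop K)ᵀ * P * T.closedLoop K)
    (hY : Y.PosSemidef) (hYS : Y = secondMoment X₀ + T.closedLoop K * Y * (T.closedLoop K)ᵀ)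
    {c : ℝ} (hc : 0 ≤ c) (hcQ : c ≤ sigmaMin T.Q) : c * ‖Y‖ ≤ T.cost X₀ K := by
  rw [cost_eq_trace hX₀ hP hPS, stein_trace_duality hPS hYS]
  exact mul_norm_le_trace hc (T.stageCost_sub_smul_one K hcQ) hY

lemma norm_closedLoop_le (T : LQRTask nx nu) (K : Matrix (Fin nu) (Fin nx) ℝ) :
    ‖T.closedLoop K‖ ≤ ‖T.A‖ + ‖T.B‖ * ‖K‖ :=
  (norm_sub_le _ _).trans (by gcongr; exact Matrix.l2_opNorm_mul _ _)

lemma norm_closedLoop_sub_le (T T' : LQRTask nx nu) (K : Matrix (Fin nu) (Fin nx) ℝ) :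
    ‖T.closedLoop K - T'.closedLoop K‖ ≤ ‖T.A - T'.A‖ + ‖T.B - T'.B‖ * ‖K‖ := by
  have h : T.closedLoop K - T'.closedLoop K = (T.A - T'.A) - (T.B - T'.B) * K := by
    rw [closedLoop, closedLoop, Matrix.sub_mul]; abel
  rw [h]
  exact (norm_sub_le _ _).trans (by gcongr; exact Matrix.l2_opNorm_mul _ _)

lemma norm_stageCost_sub_le (T T' : LQRTask nx nu) (K : Matrix (Fin nu) (Fin nx) ℝ) :
    ‖T.stageCost K - T'.stageCost K‖ ≤ ‖T.Q - T'.Q‖ + ‖K‖ ^ 2 * ‖T.R - T'.R‖ := by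
  have h : T.stageCost K - T'.stageCost K = (T.Q - T'.Q) + Kᵀ * (T.R - T'.R) * K := by
    rw [stageCost, stageCost, Matrix.mul_sub, Matrix.sub_mul]; abel
  rw [h]
  refine (norm_add_le _ _).trans (add_le_add_right ?_ _)
  calc ‖Kᵀ * (T.R - T'.R) * K‖ ≤ ‖Kᵀ‖ * ‖T.R - T'.R‖ * ‖K‖ :=
        (Matrix.l2_opNorm_mul _ _).trans (by gcongr; exact Matrix.l2_opNorm_mul _ _)
    _ = _ := by rw [l2_opNorm_transpose]; ring

/-- Stein-equation perturbation bound for the Lyapunov solutions of two tasks. -/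
lemma norm_lyapunov_sub_le {c : ℝ} (hc : 0 < c) (hcQ : c ≤ sigmaMin T.Q) (hP : P.PosSemidef)
    (hPS : P = T.stageCost K + (T.closedLoop K)ᵀ * P * T.closedLoop K)
    (hPS' : P' = T'.stageCost K + (T'.closedLoop K)ᵀ * P' * T'.closedLoop K) :
    ‖P - P'‖ ≤ ‖P‖ / c * (‖T.stageCost K - T'.stageCost K‖
      + (‖T.closedLoop K‖ + ‖T'.closedLoop K‖) * ‖P'‖ * ‖T.closedLoop K - T'.closedLoop K‖) := by
  have hS := T.stageCost_sub_smul_one K hcQ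
  generalize T.closedLoop K = L at *
  generalize T'.closedLoop K = L' at *
  generalize T.stageCost K = S at *
  generalize T'.stageCost K = S' at *
  -- The Stein operator is that of L alone, so P itself supplies the stability constant; L' enters
  -- only through the source.
  have h : P - P' = ((S - S') + ((L - L')ᵀ * P' * L + L'ᵀ * P' * (L - L')))
      + Lᵀ * (P - P') * L := by
    conv_lhs => rw [hPS, hPS']
    rw [Matrix.transpose_sub]
    noncomm_ring
  refine (norm_le_of_stein hc hP hS hPS h).trans ?_
  gcongr
  refine (norm_add_le _ _).trans (add_le_add_right ?_ _)
  calc ‖(L - L')ᵀ * P' * L + L'ᵀ * P' * (L - L')‖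
      ≤ ‖L - L'‖ * ‖P'‖ * ‖L‖ + ‖L'‖ * ‖P'‖ * ‖L - L'‖ := by
        refine (norm_add_le _ _).trans (add_le_add ?_ ?_)
        · rw [← l2_opNorm_transpose (L - L')]
          exact (norm_mul_le _ _).trans (by gcongr; exact norm_mul_le _ _)
        · rw [← l2_opNorm_transpose L']
          exact (norm_mul_le _ _).trans (by gcongr; exact norm_mul_le _ _)
    _ = _ := by ring

lemma norm_gradFactor_le (T : LQRTask nx nu) (K : Matrix (Fin nu) (Fin nx) ℝ)
    (P : Matrix (Fin nx) (Fin nx) ℝ) :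
    ‖T.gradFactor K P‖ ≤ ‖T.R‖ * ‖K‖ + ‖T.B‖ * ‖P‖ * ‖T.closedLoop K‖ := by
  refine (norm_sub_le _ _).trans (add_le_add (Matrix.l2_opNorm_mul _ _) ?_)
  rw [← l2_opNorm_transpose T.B]
  exact (Matrix.l2_opNorm_mul _ _).trans (by gcongr; exact Matrix.l2_opNorm_mul _ _)

lemma norm_gradFactor_sub_le (T T' : LQRTask nx nu) (K : Matrix (Fin nu) (Fin nx) ℝ)
    (P P' : Matrix (Fin nx) (Fin nx) ℝ) :
    ‖T.gradFactor K P - T'.gradFactor K P'‖ ≤ ‖T.R - T'.R‖ * ‖K‖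
      + (‖T.B - T'.B‖ * ‖P‖ * ‖T.closedLoop K‖ + ‖T'.B‖ * ‖P - P'‖ * ‖T.closedLoop K‖
        + ‖T'.B‖ * ‖P'‖ * ‖T.closedLoop K - T'.closedLoop K‖) := by
  have h : T.gradFactor K P - T'.gradFactor K P' = (T.R - T'.R) * K
      - ((T.B - T'.B)ᵀ * P * T.closedLoop K + T'.Bᵀ * (P - P') * T.closedLoop K
        + T'.Bᵀ * P' * (T.closedLoop K - T'.closedLoop K)) := by
    rw [gradFactor, gradFactor]
    simp only [Matrix.transpose_sub, Matrix.mul_sub, Matrix.sub_mul]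
    abel
  have h3 : ∀ (C : Matrix (Fin nx) (Fin nu) ℝ) (X L : Matrix (Fin nx) (Fin nx) ℝ),
      ‖Cᵀ * X * L‖ ≤ ‖C‖ * ‖X‖ * ‖L‖ := fun C X L => by
    rw [← l2_opNorm_transpose C]
    exact (Matrix.l2_opNorm_mul _ _).trans (by gcongr; exact Matrix.l2_opNorm_mul _ _)
  rw [h]
  refine (norm_sub_le _ _).trans (add_le_add (Matrix.l2_opNorm_mul _ _) ?_)
  exact (norm_add_le _ _).trans
    (add_le_add ((norm_add_le _ _).trans (add_le_add (h3 _ _ _) (h3 _ _ _))) (h3 _ _ _))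

end LQRTask

/-! ### The heterogeneity coefficients and the final estimate. -/

section Coefficients

variable {nx nu M : ℕ} (T : Fin M → LQRTask nx nu) (X₀ : Measure (Fin nx → ℝ))
  (K : Matrix (Fin nu) (Fin nx) ℝ)

lemma normMax_nonneg {m n : ℕ} (S : Fin M → Matrix (Fin m) (Fin n) ℝ) : 0 ≤ normMax S :=
  Real.iSup_nonneg fun _ => norm_nonneg _

lemma norm_le_normMax {m n : ℕ} (S : Fin M → Matrix (Fin m) (Fin n) ℝ) (i : Fin M) :
    ‖S i‖ ≤ normMax S :=
  le_ciSup (f := fun i => ‖S i‖) (Set.finite_range _).bddAbove i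

lemma cost_le_costMax (i : Fin M) : (T i).cost X₀ K ≤ costMax T X₀ K :=
  le_ciSup (f := fun i => (T i).cost X₀ K) (Set.finite_range _).bddAbove i

lemma sigmaMinQ_le (i : Fin M) : sigmaMinQ T ≤ sigmaMin (T i).Q :=
  ciInf_le (f := fun i => sigmaMin (T i).Q) (Set.finite_range _).bddBelow i

lemma sigmaMinQ_pos (hnx : 0 < nx) (i : Fin M) : 0 < sigmaMinQ T := by
  have : Nonempty (Fin M) := ⟨i⟩
  obtain ⟨j, hj⟩ := exists_eq_ciInf_of_finite (f := fun i => sigmaMin (T i).Q)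
  rw [sigmaMinQ, ← hj]
  exact sigmaMin_pos (T j).posDef_Q hnx

lemma costMax_nonneg : 0 ≤ costMax T X₀ K :=
  Real.iSup_nonneg fun i => (T i).cost_nonneg X₀ K

lemma sigmaMinQ_nonneg : 0 ≤ sigmaMinQ T := Real.iInf_nonneg fun _ => sigmaMin_nonneg _

lemma mu_nonneg : 0 ≤ mu X₀ := sigmaMin_nonneg _

lemma nuK_nonneg : 0 ≤ nuK T X₀ K :=
  div_nonneg (costMax_nonneg T X₀ K) (mul_nonneg (sigmaMinQ_nonneg T) (mu_nonneg X₀))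

lemma boundE_nonneg : 0 ≤ boundE T X₀ K := by
  have h1 := costMax_nonneg T X₀ K
  have h2 := mu_nonneg X₀
  have h3 : 0 ≤ nA T := normMax_nonneg _
  have h4 : 0 ≤ nB T := normMax_nonneg _
  have h5 : 0 ≤ nR T := normMax_nonneg _
  unfold boundE
  positivity

lemma hHet_nonneg : 0 ≤ hHet1 T X₀ K ∧ 0 ≤ hHet2 T X₀ K ∧ 0 ≤ hHet3 T X₀ K ∧
    0 ≤ hHet4 T X₀ K := by
  have h1 := costMax_nonneg T X₀ K
  have h2 := sigmaMinQ_nonneg T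
  have h3 := nuK_nonneg T X₀ K
  have h4 := boundE_nonneg T X₀ K
  have h5 : 0 ≤ nB T := normMax_nonneg _
  have h6 : 0 ≤ nQ T := normMax_nonneg _
  have h7 : 0 ≤ nR T := normMax_nonneg _
  have h8 : 0 ≤ nL T K := normMax_nonneg _
  have h9 : 0 ≤ nP T K := normMax_nonneg _
  unfold hHet1 hHet2 hHet3 hHet4
  generalize costMax T X₀ K = J at *
  generalize sigmaMinQ T = sQ at *
  generalize nuK T X₀ K = ν at *
  generalize boundE T X₀ K = e at *
  generalize nB T = b at *
  generalize nQ T = q at *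
  generalize nR T = r at *
  generalize nL T K = l at *
  generalize nP T K = p at *
  refine ⟨?_, ?_, ?_, ?_⟩ <;> positivity

lemma nL_le : nL T K ≤ nA T + nB T * ‖K‖ := by
  have hA : 0 ≤ nA T := normMax_nonneg _
  have hB : 0 ≤ nB T := normMax_nonneg _
  refine Real.iSup_le (fun i => ((T i).norm_closedLoop_le K).trans ?_) (by positivity)
  gcongr
  · exact norm_le_normMax (fun i => (T i).A) i
  · exact norm_le_normMax (fun i => (T i).B) i

end Coefficients

lemma sigmaMin_le_norm {n : ℕ} (hn : 0 < n) (S : Matrix (Fin n) (Fin n) ℝ) :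
    sigmaMin S ≤ ‖S‖ := by
  have : Nonempty (Fin n) := ⟨⟨0, hn⟩⟩
  obtain ⟨v, hv⟩ := exists_norm_eq (EuclideanSpace ℝ (Fin n)) zero_le_one
  have h1 := sigmaMin_mul_norm_le S v
  have h2 := (Matrix.toEuclideanCLM (𝕜 := ℝ) S).le_opNorm v
  rw [hv, mul_one] at h1 h2
  exact h1.trans h2

/-- The bound on the gradient differences dominates what the perturbation estimates yield. -/
lemma perturbation_bound_le {J sQ μ a b q r l p k s e ν ε₁ ε₂ ε₃ ε₄ : ℝ} (hJ : 0 ≤ J)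
    (hsQ : 0 < sQ) (hμ : 0 < μ) (hb : 0 ≤ b) (hq : 0 ≤ q) (hr : 0 ≤ r)
    (hl : 0 ≤ l) (hk : 0 ≤ k) (hμs : μ ≤ s) (hlab : l ≤ a + b * k)
    (hε₁ : 0 ≤ ε₁) (hε₂ : 0 ≤ ε₂) (hν : ν = J / (sQ * μ))
    (he : e = r * k + J * (b ^ 2 * k + b * a) / μ) :
    (ε₄ * k + (ε₂ * p * l
        + b * (ν * (ε₃ + k ^ 2 * ε₄ + (l + l) * (J / μ) * (ε₁ + ε₂ * k))) * l
        + b * p * (ε₁ + ε₂ * k))) * (J / sQ)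
      + e * (ν * ((l + l) * (ε₁ + ε₂ * k) * (ν * s))) ≤
    ε₁ * (J / sQ * (b * (p + 4 * l ^ 2 * (q + k ^ 2 * r) * ν ^ 2)) + 4 * e * ν ^ 2 * l * s)
      + ε₂ * (J / sQ * (l * p + b * p * k + 4 * k * l ^ 2 * (q + k ^ 2 * r) * ν ^ 2)
        + 4 * e * ν ^ 2 * k * l * s)
      + ε₃ * (J / sQ * (b * l * ν)) + ε₄ * (J / sQ * (k + k ^ 2 * b * l * ν)) := by
  -- The second summand of e dominates Jbl/μ because l ≤ a + bk, and s ≥ μ.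
  have hes : J * b * l ≤ e * s := by
    have h1 : J * b * l / μ ≤ e := by
      rw [he]
      have : J * b * l / μ ≤ J * (b ^ 2 * k + b * a) / μ := by
        refine div_le_div_of_nonneg_right ?_ hμ.le
        nlinarith [mul_le_mul_of_nonneg_left hlab (mul_nonneg hJ hb)]
      have : 0 ≤ r * k := by positivity
      linarith
    have h2 : 0 ≤ J * b * l / μ := by positivity
    calc J * b * l = J * b * l / μ * μ := by field_simp
      _ ≤ e * s := by gcongr; exact h2.trans h1
  have hJν : J / sQ * ν * (J / μ) = ν ^ 2 * J := by
    rw [hν]; field_simp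
  -- The coefficient 4eν²ls is spent in two halves: one is the covariance term, the other absorbs
  -- the variation of P caused by the closed loops. The terms with q + k²r are pure slack.
  have h1 : 0 ≤ (ε₁ + ε₂ * k) * (2 * ν ^ 2 * l * (e * s - J * b * l)) :=
    mul_nonneg (by positivity) (mul_nonneg (by positivity) (sub_nonneg.2 hes))
  have h2 : 0 ≤ ε₁ * (J / sQ * (b * (4 * l ^ 2 * (q + k ^ 2 * r) * ν ^ 2))) := by positivity
  have h3 : 0 ≤ ε₂ * (J / sQ * (4 * k * l ^ 2 * (q + k ^ 2 * r) * ν ^ 2)) := by positivity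
  have h4 : b * (l + l) * (ε₁ + ε₂ * k) * l * (J / sQ * ν * (J / μ))
      = b * (l + l) * (ε₁ + ε₂ * k) * l * (ν ^ 2 * J) := by rw [hJν]
  linear_combination h1 + h2 + h3 + h4

theorem norm_gradCost_sub_le {nx nu M : ℕ} (T : Fin M → LQRTask nx nu)
    {X₀ : Measure (Fin nx → ℝ)}
    (hX₀ : ∀ k, MemLp (fun x : Fin nx → ℝ => x k) 2 X₀) (hCov : (secondMoment X₀).PosDef)
    {K : Matrix (Fin nu) (Fin nx) ℝ} (hK : ∀ i, (T i).IsStabilizing K)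
    {i j : Fin M} {ε₁ ε₂ ε₃ ε₄ : ℝ}
    (hA : ‖(T i).A - (T j).A‖ ≤ ε₁) (hB : ‖(T i).B - (T j).B‖ ≤ ε₂)
    (hQ : ‖(T i).Q - (T j).Q‖ ≤ ε₃) (hR : ‖(T i).R - (T j).R‖ ≤ ε₄) :
    ‖(T i).gradCost X₀ K - (T j).gradCost X₀ K‖ ≤
      2 * (ε₁ * hHet1 T X₀ K + ε₂ * hHet2 T X₀ K + ε₃ * hHet3 T X₀ K + ε₄ * hHet4 T X₀ K) := by
  have hε₁ := (norm_nonneg _).trans hA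
  have hε₂ := (norm_nonneg _).trans hB
  have hε₃ := (norm_nonneg _).trans hQ
  have hε₄ := (norm_nonneg _).trans hR
  obtain ⟨hh1, hh2, hh3, hh4⟩ := hHet_nonneg T X₀ K
  -- Without states the gradients have no columns; the positivity of σ_Q and μ used below needs nx >
  -- 0.
  rcases Nat.eq_zero_or_pos nx with rfl | hnx
  · rw [Subsingleton.elim ((T i).gradCost X₀ K - (T j).gradCost X₀ K) 0, norm_zero]
    positivity
  have hsQ := sigmaMinQ_pos T hnx i
  have hμ : 0 < mu X₀ := sigmaMin_pos hCov hnx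
  have hJ := costMax_nonneg T X₀ K
  have hν := nuK_nonneg T X₀ K
  have hnB : 0 ≤ nB T := normMax_nonneg _
  have hnL : 0 ≤ nL T K := normMax_nonneg _
  have hnP : 0 ≤ nP T K := normMax_nonneg _
  have hnR : 0 ≤ nR T := normMax_nonneg _
  have hP : ∀ t, (T t).IsLyapunovSolution K ((T t).lyapunov K) := fun t =>
    (hK t).isLyapunovSolution_lyapunov
  choose Y hY hYS using fun t => (hK t).exists_covariance hCov.posSemidef
  have hgrad : ∀ t, (T t).gradCost X₀ K = (2 : ℝ) • ((T t).gradFactor K ((T t).lyapunov K) * Y t) :=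
    fun t => LQRTask.gradCost_eq hX₀ hCov (hK t) (hP t).1.posSemidef (hP t).2 (hY t) (hYS t)
  have hPJ : ∀ t, ‖(T t).lyapunov K‖ ≤ costMax T X₀ K / mu X₀ := fun t => by
    rw [le_div_iff₀' hμ]
    exact (LQRTask.mul_norm_lyapunov_le_cost hX₀ hCov (hP t).1.posSemidef (hP t).2).trans
      (cost_le_costMax T X₀ K t)
  have hYJ : ∀ t, ‖Y t‖ ≤ costMax T X₀ K / sigmaMinQ T := fun t => by
    rw [le_div_iff₀' hsQ]
    exact (LQRTask.mul_norm_covariance_le_cost hX₀ (hP t).1.posSemidef (hP t).2 (hY t) (hYS t)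
      hsQ.le (sigmaMinQ_le T t)).trans (cost_le_costMax T X₀ K t)
  have hPν : ∀ t, ‖(T t).lyapunov K‖ / sigmaMinQ T ≤ nuK T X₀ K := fun t => by
    rw [nuK, mul_comm, ← div_div]
    gcongr
    exact hPJ t
  have hYν : ∀ t, ‖Y t‖ / mu X₀ ≤ nuK T X₀ K := fun t => by
    rw [nuK, ← div_div]
    gcongr
    exact hYJ t
  have hH : (secondMoment X₀ - mu X₀ • (1 : Matrix (Fin nx) (Fin nx) ℝ)).PosSemidef :=
    PosDef.sub_smul_one hCov le_rfl
  -- Here Y serves both as the certificate and as the solution being bounded.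
  have hYs : ‖Y j‖ ≤ nuK T X₀ K * ‖secondMoment X₀‖ := by
    have h : Y j = secondMoment X₀
        + ((T j).closedLoop K)ᵀᵀ * Y j * ((T j).closedLoop K)ᵀ := by
      rw [Matrix.transpose_transpose]; exact hYS j
    exact (norm_le_of_stein hμ (hY j) hH h h).trans (by gcongr; exact hYν j)
  have hL : ∀ t, ‖(T t).closedLoop K‖ ≤ nL T K := norm_le_normMax fun t => (T t).closedLoop K
  have hBt : ∀ t, ‖(T t).B‖ ≤ nB T := norm_le_normMax fun t => (T t).B
  have hPt : ∀ t, ‖(T t).lyapunov K‖ ≤ nP T K := norm_le_normMax fun t => (T t).lyapunov K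
  have hRt : ∀ t, ‖(T t).R‖ ≤ nR T := norm_le_normMax fun t => (T t).R
  have hE : ‖(T j).gradFactor K ((T j).lyapunov K)‖ ≤ boundE T X₀ K := by
    calc _ ≤ _ := (T j).norm_gradFactor_le K _
      _ ≤ nR T * ‖K‖ + nB T * (costMax T X₀ K / mu X₀) * (nA T + nB T * ‖K‖) := by
        gcongr
        exacts [hRt j, hBt j, hPJ j, (hL j).trans (nL_le T K)]
      _ = _ := by rw [boundE]; ring
  have he := boundE_nonneg T X₀ K
  have hfin := perturbation_bound_le (q := nQ T) (r := nR T) (a := nA T) (p := nP T K) (ε₃ := ε₃)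
    (ε₄ := ε₄) hJ hsQ hμ hnB (normMax_nonneg _) hnR hnL (norm_nonneg K) (sigmaMin_le_norm hnx _)
    (nL_le T K) hε₁ hε₂ (rfl : nuK T X₀ K = _) (rfl : boundE T X₀ K = _)
  refine le_trans ?_ (mul_le_mul_of_nonneg_left hfin zero_le_two)
  clear hfin hh1 hh2 hh3 hh4
  generalize costMax T X₀ K = J at *
  generalize nuK T X₀ K = ν at *
  generalize boundE T X₀ K = e at *
  generalize nB T = b at *
  generalize nR T = r at *
  generalize nL T K = l at *
  generalize nP T K = p at *
  have hLd : ‖(T i).closedLoop K - (T j).closedLoop K‖ ≤ ε₁ + ε₂ * ‖K‖ :=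
    ((T i).norm_closedLoop_sub_le (T j) K).trans (by gcongr)
  have hSd : ‖(T i).stageCost K - (T j).stageCost K‖ ≤ ε₃ + ‖K‖ ^ 2 * ε₄ :=
    ((T i).norm_stageCost_sub_le (T j) K).trans (by gcongr)
  -- ‖Pⱼ‖ is bounded by J/μ rather than by p, the form that `perturbation_bound_le` absorbs into e.
  have hPd : ‖(T i).lyapunov K - (T j).lyapunov K‖ ≤ ν * (ε₃ + ‖K‖ ^ 2 * ε₄
      + (l + l) * (J / mu X₀) * (ε₁ + ε₂ * ‖K‖)) := by
    refine (LQRTask.norm_lyapunov_sub_le hsQ (sigmaMinQ_le T i) (hP i).1.posSemidef (hP i).2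
      (hP j).2).trans ?_
    gcongr
    exacts [hPν i, hL i, hL j, hPJ j]
  have hYd : ‖Y i - Y j‖ ≤ ν * ((l + l) * (ε₁ + ε₂ * ‖K‖)
      * (ν * ‖secondMoment X₀‖)) := by
    rw [norm_sub_rev]
    refine (LQRTask.norm_covariance_sub_le hμ hH (hY i) (hYS i) (hYS j)).trans ?_
    rw [norm_sub_rev ((T j).closedLoop K)]
    gcongr
    exacts [hYν i, hL i, hL j]
  have hEd := ((T i).norm_gradFactor_sub_le (T j) K ((T i).lyapunov K) ((T j).lyapunov K)).trans
    (show _ ≤ ε₄ * ‖K‖ + (ε₂ * p * l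
        + b * (ν * (ε₃ + ‖K‖ ^ 2 * ε₄
          + (l + l) * (J / mu X₀) * (ε₁ + ε₂ * ‖K‖))) * l
        + b * p * (ε₁ + ε₂ * ‖K‖)) by
      gcongr
      exacts [hPt i, hL i, hBt j, hL i, hBt j, hPt j])
  have hsplit : (T i).gradCost X₀ K - (T j).gradCost X₀ K
      = (2 : ℝ) • (((T i).gradFactor K ((T i).lyapunov K)
          - (T j).gradFactor K ((T j).lyapunov K)) * Y i
        + (T j).gradFactor K ((T j).lyapunov K) * (Y i - Y j)) := by
    rw [hgrad, hgrad, ← smul_sub, Matrix.sub_mul, Matrix.mul_sub, sub_add_sub_cancel]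
  rw [hsplit, norm_smul, Real.norm_ofNat]
  refine mul_le_mul_of_nonneg_left ?_ zero_le_two
  exact (norm_add_le _ _).trans (add_le_add
    ((Matrix.l2_opNorm_mul _ _).trans (mul_le_mul hEd (hYJ i) (norm_nonneg _) (by positivity)))
    ((Matrix.l2_opNorm_mul _ _).trans (mul_le_mul hE hYd (norm_nonneg _) he)))

end MetaLQR

theorem mainTheorem5 {nx nu M : ℕ}
    -- the tasks, and the law of the initial state (finite second moments, `Σ₀ ≻ 0`)
    (T : Fin M → MetaLQR.LQRTask nx nu)
    (X₀ : MeasureTheory.Measure (Fin nx → ℝ)) [MeasureTheory.IsProbabilityMeasure X₀]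
    (hX₀ : ∀ k, MeasureTheory.MemLp (fun x : Fin nx → ℝ => x k) 2 X₀)
    (hCov : (MetaLQR.secondMoment X₀).PosDef)
    -- a controller in the MAML stabilizing sub-level set of the initial controller `K₀`
    (K₀ : Matrix (Fin nu) (Fin nx) ℝ) (_hK₀ : ∀ i, (T i).IsStabilizing K₀)
    (γ : Fin M → ℝ) (_hγ : ∀ i, 0 < γ i)
    (K : Matrix (Fin nu) (Fin nx) ℝ) (hK : K ∈ MetaLQR.stabSublevelML T X₀ K₀ γ)
    -- two tasks and their heterogeneity levels
    (i j : Fin M) (ε₁ ε₂ ε₃ ε₄ : ℝ)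
    (hA : ‖(T i).A - (T j).A‖ ≤ ε₁) (hB : ‖(T i).B - (T j).B‖ ≤ ε₂)
    (hQ : ‖(T i).Q - (T j).Q‖ ≤ ε₃) (hR : ‖(T i).R - (T j).R‖ ≤ ε₄) :
    -- the gradients exist
    DifferentiableAt ℝ ((T i).cost X₀) K ∧ DifferentiableAt ℝ ((T j).cost X₀) K ∧
    -- the coefficients are nonnegative
    0 ≤ MetaLQR.hHet1 T X₀ K ∧ 0 ≤ MetaLQR.hHet2 T X₀ K ∧
    0 ≤ MetaLQR.hHet3 T X₀ K ∧ 0 ≤ MetaLQR.hHet4 T X₀ K ∧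
    -- system and cost heterogeneity
    ‖(T i).gradCost X₀ K - (T j).gradCost X₀ K‖ ≤
      2 * (ε₁ * MetaLQR.hHet1 T X₀ K + ε₂ * MetaLQR.hHet2 T X₀ K
        + ε₃ * MetaLQR.hHet3 T X₀ K + ε₄ * MetaLQR.hHet4 T X₀ K) ∧
    -- system heterogeneity only
    ((T i).Q = (T j).Q → (T i).R = (T j).R →
      ‖(T i).gradCost X₀ K - (T j).gradCost X₀ K‖ ≤
        2 * (ε₁ * MetaLQR.hHet1 T X₀ K + ε₂ * MetaLQR.hHet2 T X₀ K)) ∧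
    -- cost heterogeneity only
    ((T i).A = (T j).A → (T i).B = (T j).B →
      ‖(T i).gradCost X₀ K - (T j).gradCost X₀ K‖ ≤
        2 * (ε₃ * MetaLQR.hHet3 T X₀ K + ε₄ * MetaLQR.hHet4 T X₀ K)) := by
  have hstab : ∀ t, (T t).IsStabilizing K := fun t => (Set.mem_iInter.1 hK t).1
  have hdiff : ∀ t, DifferentiableAt ℝ ((T t).cost X₀) K := fun t => by
    obtain ⟨hP, hPS⟩ := (hstab t).isLyapunovSolution_lyapunov
    obtain ⟨Y, hY, hYS⟩ := (hstab t).exists_covariance hCov.posSemidef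
    exact (MetaLQR.LQRTask.hasFDerivAt_cost hX₀ hCov (hstab t) hP.posSemidef hPS hY
      hYS).differentiableAt
  obtain ⟨h1, h2, h3, h4⟩ := MetaLQR.hHet_nonneg T X₀ K
  refine ⟨hdiff i, hdiff j, h1, h2, h3, h4,
    MetaLQR.norm_gradCost_sub_le T hX₀ hCov hstab hA hB hQ hR, fun hQ0 hR0 => ?_,
    fun hA0 hB0 => ?_⟩
  -- Equal data allow the level 0, so the corresponding terms vanish whatever the given levels are.
  · simpa using MetaLQR.norm_gradCost_sub_le T hX₀ hCov hstab hA hB (ε₃ := 0) (ε₄ := 0)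
      (by simp [hQ0]) (by simp [hR0])
  · simpa using MetaLQR.norm_gradCost_sub_le T hX₀ hCov hstab (ε₁ := 0) (ε₂ := 0)
      (by simp [hA0]) (by simp [hB0]) hQ hR
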